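/- For $n\in\mathbb Z$ and $t\in\mathbb R$ let $$J_n(t)=\frac{i^n}{2\pi}\int_0^{2\pi}e^{ink-it\cos k}\,dk$$ be the Bessel function of the first kind of order $n$. For all $\gamma\in[0,1]$, $p>2+2\gamma$ and $n\in\mathbb Z$, the integral below converges and $$\int_1^\infty t^\gamma|J_n(t)|^p\,dt\le C_p^\gamma\,\varkappa_p^\gamma(n)^p,$$ where $$C_p^\gamma=\begin{cases}8\Bigl(\dfrac1{p-2-2\gamma}+\dfrac1{4-p}\Bigr),&2+2\gamma<p<4,\\[2mm] \dfrac4{1-\gamma},&p=4,\\[2mm] \dfrac{14\cdot2^{p/4}}{p-4},&p>4,\end{cases}$$ $\varkappa_p^\gamma(0)=1$, and for $n\neq0$ $$\varkappa_p^\gamma(n)=\begin{cases}|n|^{-\frac12+\frac{1+\gamma}p},&p<4,\\[1mm] |n|^{-\frac{1-\gamma}4}(1+\log|n|)^{\frac14},&p=4,\\[1mm] |n|^{-\frac13+\frac1{3p}+\frac\gamma p},&p>4.\end{cases}$$ -/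

import Mathlib

noncomputable section

/-- The Bessel function of the first kind of integer order `n` at a real argument `t`, through its
integral representation
`J_n(t) = (i ^ n / (2 π)) * ∫_0^{2π} exp (i n k - i t cos k) dk`
(whose value is real). -/
def besselJ (n : ℤ) (t : ℝ) : ℂ :=
  Complex.I ^ n / (2 * (Real.pi : ℂ)) *
    ∫ k in (0 : ℝ)..(2 * Real.pi),
      Complex.exp (Complex.I * (n : ℂ) * (k : ℂ) - Complex.I * (t : ℂ) * (Real.cos k : ℂ))

/-- The constant `C_p^γ`. It is used for `0 ≤ γ ≤ 1` and `p > 2 + 2 γ` only. -/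
def besselConst (γ p : ℝ) : ℝ :=
  if p < 4 then 8 * (1 / (p - 2 - 2 * γ) + 1 / (4 - p))
  else if p = 4 then 4 / (1 - γ)
  else 14 * (2 : ℝ) ^ (p / 4) / (p - 4)

/-- The sequence `ϰ_p^γ(n)`, `n ∈ ℤ`. It is used for `0 ≤ γ ≤ 1` and `p > 2 + 2 γ` only. -/
def besselKappa (γ p : ℝ) (n : ℤ) : ℝ :=
  if n = 0 then 1
  else if p < 4 then |(n : ℝ)| ^ (-(1 / 2) + (1 + γ) / p)
  else if p = 4 then
    |(n : ℝ)| ^ (-((1 - γ) / 4)) * (1 + Real.log |(n : ℝ)|) ^ ((1 : ℝ) / 4)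
  else |(n : ℝ)| ^ (-(1 / 3) + 1 / (3 * p) + γ / p)

end

/-! Up to a phase, `besselJ n` is the real function J_n, and |J_{-n}| = |J_n|, so n ≥ 0 may be
assumed. For n ≥ 1 everything rests on two pointwise bounds around the turning point t = n: |t² -
n²| J_n⁴ ≤ 9/16 for t > 0, and m⁴ J_n⁴ ≤ 7/10 with m = n^(1/3). They are raised to the power s = p/4
and integrated separately over t < n - δ, |t - n| < δ, n + δ < t < 2n and t > 2n. For p < 4 the
singularity |t - n|^(-s) is integrable and δ = 0. For p ≥ 4 the second bound covers a window of
half-width δ = n^(1/3), the Airy scale. For n = 0 only a power tail on (1, ∞) occurs.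

Beyond the turning point, Bessel's equation in Liouville normal form is u'' + P u = 0 with P
decreasing, so the Sonin function u² + u'²/P increases and is bounded by its limit at infinity
(`sqrt_mul_besselReal_sq_le`). An upper bound 3/4 for that limit comes from a decreasing energy for
the pair J_0, J_1, estimated at t = 1, and the recurrence carries it to every order with error
O(1/t).

At the turning point, the equation shows that J_n falls by at most 1/24 of a local maximum before t
= n + m/2, where the previous bound applies (`mul_besselReal_sq_le`). Before it, t J_n' ≥ √(n² - t²)
J_n (where J_n ≥ 0) makes (n² - t²) J_n⁴ increase up to a point where the m⁴ bound takes over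
(`sub_sq_mul_besselReal_pow_four_le`). -/

noncomputable section

open MeasureTheory

/-! ### Real form, recurrences and Bessel's equation. -/

/-- The Bessel function of integer order as a real integral. -/
def besselReal (n : ℤ) (t : ℝ) : ℝ :=
  1 / (2 * Real.pi) * ∫ θ in (0 : ℝ)..(2 * Real.pi), Real.cos (n * θ - t * Real.sin θ)

theorem norm_besselJ_eq_norm_integral (n : ℤ) (t : ℝ) :
    ‖besselJ n t‖ = 1 / (2 * Real.pi) * ‖∫ k in (0 : ℝ)..(2 * Real.pi),
      Complex.exp (Complex.I * (n : ℂ) * (k : ℂ) - Complex.I * (t : ℂ) * (Real.cos k : ℂ))‖ := by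
  unfold besselJ
  rw [norm_mul, norm_div, norm_zpow, Complex.norm_I, one_zpow, norm_mul, Complex.norm_real,
    Real.norm_of_nonneg Real.pi_pos.le]
  norm_num

theorem norm_besselJ_neg (n : ℤ) (t : ℝ) : ‖besselJ (-n) t‖ = ‖besselJ n t‖ := by
  rw [norm_besselJ_eq_norm_integral, norm_besselJ_eq_norm_integral]
  have h := intervalIntegral.integral_comp_sub_left (a := 0) (b := 2 * Real.pi)
    (fun k : ℝ => Complex.exp (Complex.I * ((n : ℤ) : ℂ) * (k : ℂ)
      - Complex.I * (t : ℂ) * (Real.cos k : ℂ))) (2 * Real.pi)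
  rw [sub_self, sub_zero] at h
  rw [← h]
  congr 3
  ext k
  have h2 : Complex.I * (n : ℂ) * ((2 * Real.pi - k : ℝ) : ℂ)
      - Complex.I * (t : ℂ) * (Real.cos (2 * Real.pi - k) : ℂ)
      = (Complex.I * ((-n : ℤ) : ℂ) * (k : ℂ) - Complex.I * (t : ℂ) * (Real.cos k : ℂ))
        + n * (2 * Real.pi * Complex.I) := by
    rw [Real.cos_two_pi_sub]
    push_cast
    ring
  simp only [h2, Complex.exp_add, Complex.exp_int_mul_two_pi_mul_I, mul_one]

/-- The shift k = θ - π/2 turns cos into sin and extracts a unimodular factor; the remaining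
imaginary part is odd under θ ↦ 2π - θ and integrates to zero. -/
theorem norm_besselJ_eq_abs (n : ℤ) (t : ℝ) : ‖besselJ n t‖ = |besselReal n t| := by
  rw [norm_besselJ_eq_norm_integral]
  set g : ℝ → ℂ := fun k => Complex.exp (Complex.I * (n : ℂ) * (k : ℂ)
    - Complex.I * (t : ℂ) * (Real.cos k : ℂ)) with hg
  have hper : Function.Periodic g (2 * Real.pi) := by
    intro k
    have h2 : Complex.I * (n : ℂ) * ((k + 2 * Real.pi : ℝ) : ℂ)
        - Complex.I * (t : ℂ) * (Real.cos (k + 2 * Real.pi) : ℂ)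
        = (Complex.I * (n : ℂ) * (k : ℂ) - Complex.I * (t : ℂ) * (Real.cos k : ℂ))
          + n * (2 * Real.pi * Complex.I) := by
      rw [Real.cos_add_two_pi]
      push_cast
      ring
    simp only [hg, h2, Complex.exp_add, Complex.exp_int_mul_two_pi_mul_I, mul_one]
  have h1 : ∫ k in (0 : ℝ)..(2 * Real.pi), g k
      = ∫ θ in (0 : ℝ)..(2 * Real.pi), g (θ - Real.pi / 2) := by
    rw [intervalIntegral.integral_comp_sub_right]
    have := hper.intervalIntegral_add_eq 0 (0 - Real.pi / 2)
    rw [zero_add] at this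
    rw [this]
    congr 1
    ring
  have h2 : ∀ θ : ℝ, g (θ - Real.pi / 2) = Complex.exp ((-(n * (Real.pi / 2)) : ℝ) * Complex.I) *
      ((Real.cos (n * θ - t * Real.sin θ) : ℂ)
        + (Real.sin (n * θ - t * Real.sin θ) : ℂ) * Complex.I) := by
    intro θ
    rw [Complex.ofReal_cos, Complex.ofReal_sin, ← Complex.exp_mul_I, ← Complex.exp_add]
    simp only [hg, Real.cos_sub_pi_div_two]
    congr 1
    push_cast
    ring
  have hc : IntervalIntegrable (fun θ : ℝ => ((Real.cos (n * θ - t * Real.sin θ) : ℝ) : ℂ))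
      volume 0 (2 * Real.pi) := (by fun_prop : Continuous _).intervalIntegrable _ _
  have hs : IntervalIntegrable (fun θ : ℝ =>
      ((Real.sin (n * θ - t * Real.sin θ) : ℝ) : ℂ) * Complex.I)
      volume 0 (2 * Real.pi) := (by fun_prop : Continuous _).intervalIntegrable _ _
  have h3 : ∫ θ in (0 : ℝ)..(2 * Real.pi), Real.sin (n * θ - t * Real.sin θ) = 0 := by
    have h := intervalIntegral.integral_comp_sub_left (a := 0) (b := 2 * Real.pi)
      (fun θ : ℝ => Real.sin (n * θ - t * Real.sin θ)) (2 * Real.pi)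
    rw [sub_self, sub_zero] at h
    have h' : ∀ θ : ℝ, Real.sin (n * (2 * Real.pi - θ) - t * Real.sin (2 * Real.pi - θ))
        = - Real.sin (n * θ - t * Real.sin θ) := by
      intro θ
      rw [Real.sin_two_pi_sub, ← Real.sin_neg (n * θ - t * Real.sin θ),
        ← Real.sin_add_int_mul_two_pi (-(n * θ - t * Real.sin θ)) n]
      congr 1
      ring
    simp only [h', intervalIntegral.integral_neg] at h
    linarith
  rw [h1]
  simp only [h2]
  rw [intervalIntegral.integral_const_mul, intervalIntegral.integral_add hc hs,
    intervalIntegral.integral_mul_const, intervalIntegral.integral_ofReal,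
    intervalIntegral.integral_ofReal, h3, norm_mul, Complex.norm_exp_ofReal_mul_I]
  simp only [Complex.ofReal_zero, zero_mul, add_zero, one_mul, Complex.norm_real, besselReal,
    abs_mul, Real.norm_eq_abs]
  rw [abs_of_pos (show (0 : ℝ) < 1 / (2 * Real.pi) by positivity)]

theorem hasDerivAt_besselReal (n : ℤ) (t : ℝ) :
    HasDerivAt (besselReal n) ((besselReal (n - 1) t - besselReal (n + 1) t) / 2) t := by
  have key := intervalIntegral.hasDerivAt_integral_of_dominated_loc_of_deriv_le
    (F := fun (x θ : ℝ) => Real.cos (n * θ - x * Real.sin θ))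
    (F' := fun (x θ : ℝ) => Real.sin θ * Real.sin (n * θ - x * Real.sin θ))
    (x₀ := t) (s := Set.univ) (a := 0) (b := 2 * Real.pi) (bound := fun _ => 1) (μ := volume)
    Filter.univ_mem
    (Filter.Eventually.of_forall fun x => (by fun_prop : Continuous _).aestronglyMeasurable)
    ((by fun_prop : Continuous _).intervalIntegrable _ _)
    (by fun_prop : Continuous _).aestronglyMeasurable
    (Filter.Eventually.of_forall fun θ _ x _ => by
      rw [norm_mul]
      exact mul_le_one₀ (Real.abs_sin_le_one _) (norm_nonneg _) (Real.abs_sin_le_one _))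
    (by simp)
    (Filter.Eventually.of_forall fun θ _ x _ => by
      have h := (((hasDerivAt_id x).mul_const (Real.sin θ)).const_sub (n * θ)).cos
      refine h.congr_deriv ?_
      simp only [id]
      ring)
  refine (key.2.const_mul (1 / (2 * Real.pi))).congr_deriv ?_
  unfold besselReal
  have h1 : ∀ θ : ℝ, Real.sin θ * Real.sin (n * θ - t * Real.sin θ)
      = (Real.cos (((n - 1 : ℤ) : ℝ) * θ - t * Real.sin θ)
        - Real.cos (((n + 1 : ℤ) : ℝ) * θ - t * Real.sin θ)) * (1 / 2) := by
    intro θ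
    have e1 : ((n - 1 : ℤ) : ℝ) * θ - t * Real.sin θ = (n * θ - t * Real.sin θ) - θ := by
      push_cast; ring
    have e2 : ((n + 1 : ℤ) : ℝ) * θ - t * Real.sin θ = (n * θ - t * Real.sin θ) + θ := by
      push_cast; ring
    rw [e1, e2, Real.cos_sub _ θ, Real.cos_add]
    ring
  simp only [h1]
  rw [intervalIntegral.integral_mul_const, intervalIntegral.integral_sub
    ((by fun_prop : Continuous _).intervalIntegrable _ _)
    ((by fun_prop : Continuous _).intervalIntegrable _ _)]
  ring

/-- The derivative of sin(nθ - t sin θ) has zero integral over a period. -/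
theorem two_mul_besselReal (n : ℤ) (t : ℝ) :
    2 * n * besselReal n t = t * (besselReal (n - 1) t + besselReal (n + 1) t) := by
  have h : ∫ θ in (0 : ℝ)..(2 * Real.pi),
      Real.cos (n * θ - t * Real.sin θ) * (n - t * Real.cos θ) = 0 := by
    rw [intervalIntegral.integral_eq_sub_of_hasDerivAt
      (f := fun θ => Real.sin (n * θ - t * Real.sin θ))]
    · have h0 := Real.sin_add_int_mul_two_pi 0 n
      rw [zero_add, Real.sin_zero] at h0
      simp [h0]
    · intro θ _
      have := (((hasDerivAt_id θ).const_mul (n : ℝ)).sub ((Real.hasDerivAt_sin θ).const_mul t)).sin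
      simpa using this
    · exact (by fun_prop : Continuous _).intervalIntegrable _ _
  have h1 : ∀ θ : ℝ, Real.cos (n * θ - t * Real.sin θ) * (n - t * Real.cos θ)
      = n * Real.cos (n * θ - t * Real.sin θ)
        - t / 2 * (Real.cos (((n - 1 : ℤ) : ℝ) * θ - t * Real.sin θ)
        + Real.cos (((n + 1 : ℤ) : ℝ) * θ - t * Real.sin θ)) := by
    intro θ
    have e1 : ((n - 1 : ℤ) : ℝ) * θ - t * Real.sin θ = (n * θ - t * Real.sin θ) - θ := by
      push_cast; ring
    have e2 : ((n + 1 : ℤ) : ℝ) * θ - t * Real.sin θ = (n * θ - t * Real.sin θ) + θ := by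
      push_cast; ring
    rw [e1, e2, Real.cos_sub _ θ, Real.cos_add]
    ring
  simp only [h1] at h
  rw [intervalIntegral.integral_sub
    ((by fun_prop : Continuous _).intervalIntegrable _ _)
    ((by fun_prop : Continuous _).intervalIntegrable _ _),
    intervalIntegral.integral_const_mul, intervalIntegral.integral_const_mul,
    intervalIntegral.integral_add
    ((by fun_prop : Continuous _).intervalIntegrable _ _)
    ((by fun_prop : Continuous _).intervalIntegrable _ _)] at h
  unfold besselReal
  linear_combination (1 / Real.pi) * h

theorem besselReal_neg_one (t : ℝ) : besselReal (-1) t = -besselReal 1 t := by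
  have h := two_mul_besselReal 0 t
  rcases eq_or_ne t 0 with rfl | ht
  · have h1 := two_mul_besselReal 1 0
    have h2 := two_mul_besselReal (-1) 0
    push_cast at h1 h2
    linarith
  · have : t * (besselReal (0 - 1) t + besselReal (0 + 1) t) = 0 := by rw [← h]; simp
    have := (mul_eq_zero.mp this).resolve_left ht
    norm_num at this
    linarith

/-- The derivative of `besselReal n`. -/
def besselDeriv (n : ℤ) (t : ℝ) : ℝ := (besselReal (n - 1) t - besselReal (n + 1) t) / 2

theorem continuous_besselReal (n : ℤ) : Continuous (besselReal n) :=
  continuous_iff_continuousAt.mpr fun t => (hasDerivAt_besselReal n t).continuousAt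

theorem mul_besselDeriv (n : ℤ) (t : ℝ) :
    t * besselDeriv n t = n * besselReal n t - t * besselReal (n + 1) t := by
  have := two_mul_besselReal n t
  unfold besselDeriv
  linarith

theorem mul_besselDeriv_add_one (n : ℤ) (t : ℝ) :
    t * besselDeriv (n + 1) t = t * besselReal n t - (n + 1) * besselReal (n + 1) t := by
  have := two_mul_besselReal (n + 1) t
  unfold besselDeriv
  push_cast at this
  rw [add_sub_cancel_right] at this ⊢
  linarith

theorem continuous_besselDeriv (n : ℤ) : Continuous (besselDeriv n) :=
  ((continuous_besselReal _).sub (continuous_besselReal _)).div_const _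

/-- Bessel's equation. -/
theorem hasDerivAt_mul_besselDeriv (n : ℤ) {t : ℝ} (ht : t ≠ 0) :
    HasDerivAt (fun x => x * besselDeriv n x) ((n ^ 2 - t ^ 2) / t * besselReal n t) t := by
  have h1 : (fun x => x * besselDeriv n x)
      = fun x => n * besselReal n x - x * besselReal (n + 1) x :=
    funext (mul_besselDeriv n)
  rw [h1]
  refine (((hasDerivAt_besselReal n t).const_mul (n : ℝ)).sub
    ((hasDerivAt_id t).mul (hasDerivAt_besselReal (n + 1) t))).congr_deriv ?_
  change n * besselDeriv n t - (1 * besselReal (n + 1) t + t * besselDeriv (n + 1) t) = _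
  rw [mul_besselDeriv_add_one]
  field_simp
  linear_combination (n : ℝ) * mul_besselDeriv n t

theorem besselReal_zero_right {n : ℤ} (hn : n ≠ 0) : besselReal n 0 = 0 := by
  have h := two_mul_besselReal n 0
  have : (n : ℝ) ≠ 0 := by exact_mod_cast hn
  simpa [this] using h

/-! ### The amplitude at infinity. -/

theorem integral_sin_sq_period : ∫ θ in (0 : ℝ)..(2 * Real.pi), Real.sin θ ^ 2 = Real.pi := by
  rw [integral_sin_sq]
  simp

theorem integral_sin_pow_four_period :
    ∫ θ in (0 : ℝ)..(2 * Real.pi), Real.sin θ ^ 4 = 3 * Real.pi / 4 := by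
  have := integral_sin_pow (a := 0) (b := 2 * Real.pi) 2
  norm_num [integral_sin_sq_period] at this
  rw [this]
  ring

/-- The Taylor bound |cos x - (1 - x²/2)| ≤ (5/96) x⁴, averaged at x = sin θ; the mean of sin⁴ is
3/8. This serves to estimate the energy at t = 1. -/
theorem abs_besselReal_zero_one_sub_le : |besselReal 0 1 - 3 / 4| ≤ 5 / 256 := by
  have h1 : ∀ θ : ℝ, 1 - Real.sin θ ^ 2 / 2 - 5 / 96 * Real.sin θ ^ 4 ≤ Real.cos (Real.sin θ)
      ∧ Real.cos (Real.sin θ) ≤ 1 - Real.sin θ ^ 2 / 2 + 5 / 96 * Real.sin θ ^ 4 := by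
    intro θ
    have h := abs_le.mp (Real.cos_bound (Real.abs_sin_le_one θ))
    have h4 : |Real.sin θ| ^ 4 = Real.sin θ ^ 4 := Even.pow_abs (by decide) _
    rw [h4] at h
    constructor <;> linarith [h.1, h.2]
  have hI : ∀ c : ℝ, ∫ θ in (0 : ℝ)..(2 * Real.pi),
      (1 - Real.sin θ ^ 2 / 2 + c * Real.sin θ ^ 4) = 3 / 2 * Real.pi + c * (3 * Real.pi / 4) := by
    intro c
    rw [intervalIntegral.integral_add, intervalIntegral.integral_sub,
      intervalIntegral.integral_div, intervalIntegral.integral_const_mul, integral_sin_sq_period,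
      integral_sin_pow_four_period, intervalIntegral.integral_const]
    · simp only [smul_eq_mul]
      ring
    all_goals exact (by fun_prop : Continuous _).intervalIntegrable _ _
  have hJ : besselReal 0 1 = 1 / (2 * Real.pi) *
      ∫ θ in (0 : ℝ)..(2 * Real.pi), Real.cos (Real.sin θ) := by
    simp [besselReal]
  have hup := intervalIntegral.integral_mono_on (μ := volume) Real.two_pi_pos.le
    ((by fun_prop : Continuous fun θ : ℝ => Real.cos (Real.sin θ)).intervalIntegrable _ _)
    ((by fun_prop : Continuous fun θ : ℝ =>
      1 - Real.sin θ ^ 2 / 2 + 5 / 96 * Real.sin θ ^ 4).intervalIntegrable _ _)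
    (fun θ _ => (h1 θ).2)
  have hlo := intervalIntegral.integral_mono_on (μ := volume) Real.two_pi_pos.le
    ((by fun_prop : Continuous fun θ : ℝ =>
      1 - Real.sin θ ^ 2 / 2 + (-(5 / 96)) * Real.sin θ ^ 4).intervalIntegrable _ _)
    ((by fun_prop : Continuous fun θ : ℝ => Real.cos (Real.sin θ)).intervalIntegrable _ _)
    (fun θ _ => by linarith [(h1 θ).1])
  rw [hI] at hup hlo
  have hpi := Real.pi_pos
  rw [hJ, abs_le]
  constructor
  · rw [div_mul_eq_mul_div, one_mul, le_sub_iff_add_le, le_div_iff₀ (by positivity)]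
    linarith
  · rw [div_mul_eq_mul_div, one_mul, sub_le_iff_le_add, div_le_iff₀ (by positivity)]
    linarith

theorem abs_besselReal_one_one_sub_le : |besselReal 1 1 - 7 / 16| ≤ 5 / 256 := by
  -- The coefficients are 1/6 ± 5/96: the cubic Taylor term of sin and its error.
  have h1 : ∀ θ : ℝ, Real.sin θ ^ 2 - 21 / 96 * Real.sin θ ^ 4
        ≤ Real.sin θ * Real.sin (Real.sin θ)
      ∧ Real.sin θ * Real.sin (Real.sin θ) ≤ Real.sin θ ^ 2 - 11 / 96 * Real.sin θ ^ 4 := by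
    intro θ
    have h4 : |Real.sin θ| ^ 4 = Real.sin θ ^ 4 := Even.pow_abs (by decide) _
    have h3 : |Real.sin θ| ^ 5 ≤ Real.sin θ ^ 4 :=
      h4 ▸ pow_le_pow_of_le_one (abs_nonneg _) (Real.abs_sin_le_one θ) (by norm_num)
    have h : |Real.sin (Real.sin θ) - (Real.sin θ - Real.sin θ ^ 3 / 6)|
        ≤ Real.sin θ ^ 4 * (5 / 96) :=
      (Real.sin_bound (Real.abs_sin_le_one θ)).trans (by
        linarith [pow_nonneg (abs_nonneg (Real.sin θ)) 5])
    have h5 : |Real.sin θ * (Real.sin (Real.sin θ) - (Real.sin θ - Real.sin θ ^ 3 / 6))|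
        ≤ 1 * (Real.sin θ ^ 4 * (5 / 96)) := by
      rw [abs_mul]
      exact mul_le_mul (Real.abs_sin_le_one θ) h (abs_nonneg _) zero_le_one
    have h6 := abs_le.mp h5
    constructor <;> linarith [h6.1, h6.2]
  have hI : ∀ c : ℝ, ∫ θ in (0 : ℝ)..(2 * Real.pi),
      (Real.sin θ ^ 2 - c * Real.sin θ ^ 4) = Real.pi - c * (3 * Real.pi / 4) := by
    intro c
    rw [intervalIntegral.integral_sub,
      intervalIntegral.integral_const_mul, integral_sin_sq_period, integral_sin_pow_four_period]
    all_goals exact (by fun_prop : Continuous _).intervalIntegrable _ _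
  have hz : ∫ θ in (0 : ℝ)..(2 * Real.pi), Real.cos θ * Real.cos (Real.sin θ) = 0 := by
    rw [intervalIntegral.integral_eq_sub_of_hasDerivAt (f := fun θ => Real.sin (Real.sin θ))]
    · simp
    · intro θ _
      simpa [mul_comm] using (Real.hasDerivAt_sin θ).sin
    · exact (by fun_prop : Continuous _).intervalIntegrable _ _
  have hJ : besselReal 1 1 = 1 / (2 * Real.pi) *
      ∫ θ in (0 : ℝ)..(2 * Real.pi), Real.sin θ * Real.sin (Real.sin θ) := by
    simp only [besselReal, Int.cast_one, one_mul, Real.cos_sub]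
    rw [intervalIntegral.integral_add, hz, zero_add]
    all_goals exact (by fun_prop : Continuous _).intervalIntegrable _ _
  have hup := intervalIntegral.integral_mono_on (μ := volume) Real.two_pi_pos.le
    ((by fun_prop : Continuous fun θ : ℝ =>
      Real.sin θ * Real.sin (Real.sin θ)).intervalIntegrable _ _)
    ((by fun_prop : Continuous fun θ : ℝ =>
      Real.sin θ ^ 2 - 11 / 96 * Real.sin θ ^ 4).intervalIntegrable _ _)
    (fun θ _ => (h1 θ).2)
  have hlo := intervalIntegral.integral_mono_on (μ := volume) Real.two_pi_pos.le
    ((by fun_prop : Continuous fun θ : ℝ =>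
      Real.sin θ ^ 2 - 21 / 96 * Real.sin θ ^ 4).intervalIntegrable _ _)
    ((by fun_prop : Continuous fun θ : ℝ =>
      Real.sin θ * Real.sin (Real.sin θ)).intervalIntegrable _ _)
    (fun θ _ => (h1 θ).1)
  rw [hI] at hup hlo
  have hpi := Real.pi_pos
  rw [hJ, abs_le]
  constructor
  · rw [div_mul_eq_mul_div, one_mul, le_sub_iff_add_le, le_div_iff₀ (by positivity)]
    linarith
  · rw [div_mul_eq_mul_div, one_mul, sub_le_iff_le_add, div_le_iff₀ (by positivity)]
    linarith

/-- The lower-order terms are chosen so that the derivative is exactly -J_0²/(2t²); the left side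
therefore decreases, and its value at t = 1 is controlled by the two estimates above. -/
theorem besselReal_zero_energy_le {t : ℝ} (ht : 1 ≤ t) :
    t * (besselReal 0 t ^ 2 + besselReal 1 t ^ 2) + besselReal 0 t ^ 2 / (2 * t)
      - besselReal 0 t * besselReal 1 t ≤ 3 / 4 := by
  set E : ℝ → ℝ := fun t => t * (besselReal 0 t ^ 2 + besselReal 1 t ^ 2)
    + besselReal 0 t ^ 2 / (2 * t) - besselReal 0 t * besselReal 1 t with hE
  have hd : ∀ x : ℝ, 0 < x → HasDerivAt E (-(besselReal 0 x ^ 2 / (2 * x ^ 2))) x := by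
    intro x hx
    have h0 : HasDerivAt (besselReal 0) (-besselReal 1 x) x := by
      refine (hasDerivAt_besselReal 0 x).congr_deriv ?_
      have := besselReal_neg_one x
      norm_num
      linarith
    have h1 : HasDerivAt (besselReal 1) (besselReal 0 x - besselReal 1 x / x) x := by
      refine (hasDerivAt_besselReal 1 x).congr_deriv ?_
      have := mul_besselDeriv_add_one 0 x
      unfold besselDeriv at this
      norm_num at this ⊢
      field_simp
      linarith
    refine ((((hasDerivAt_id x).mul ((h0.pow 2).add (h1.pow 2))).add
      ((h0.pow 2).div ((hasDerivAt_id x).const_mul 2) (by simp; positivity))).sub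
      (h0.mul h1)).congr_deriv ?_
    simp only [id, Pi.add_apply, Pi.pow_apply]
    field_simp
    ring
  have hanti : AntitoneOn E (Set.Ici 1) := by
    refine antitoneOn_of_deriv_nonpos (convex_Ici 1) ?_ ?_ ?_
    · intro x hx
      exact (hd x (lt_of_lt_of_le one_pos hx)).continuousAt.continuousWithinAt
    · intro x hx
      rw [interior_Ici] at hx
      exact (hd x (one_pos.trans hx)).differentiableAt.differentiableWithinAt
    · intro x hx
      rw [interior_Ici] at hx
      rw [(hd x (one_pos.trans hx)).deriv]
      have : 0 ≤ besselReal 0 x ^ 2 / (2 * x ^ 2) := by positivity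
      linarith
  refine (hanti Set.self_mem_Ici ht ht).trans ?_
  have h0 := abs_le.mp abs_besselReal_zero_one_sub_le
  have h1 := abs_le.mp abs_besselReal_one_one_sub_le
  simp only [hE]
  nlinarith [h0.1, h0.2, h1.1, h1.2]

/-- Consecutive Bessel functions jointly have at most the amplitude `√(3 / (4 t))` at infinity. -/
theorem exists_sq_add_sq_le (n : ℕ) : ∃ C : ℝ, 0 ≤ C ∧ ∀ t : ℝ, 1 ≤ t →
    t * (besselReal n t ^ 2 + besselReal (n + 1) t ^ 2) ≤ 3 / 4 + C / t := by
  induction n with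
  | zero =>
    refine ⟨3 / 4, by norm_num, fun t ht => ?_⟩
    have h := besselReal_zero_energy_le ht
    have h0 : 0 ≤ besselReal 0 t ^ 2 / (2 * t) := by positivity
    norm_num
    set a := besselReal 0 t
    set b := besselReal 1 t
    -- As t ≥ 1, t(a² + b²) - ab ≥ t|ab|, so the cross term of the energy is O(1/t).
    have h1 : t * (a * b) ≤ 3 / 4 := by
      nlinarith [sq_nonneg (a - b), sq_nonneg (a + b)]
    have h2 : a * b ≤ 3 / 4 / t := by
      rw [le_div_iff₀ (by linarith)]
      linarith
    linarith
  | succ k ih =>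
    obtain ⟨C, hC, h⟩ := ih
    refine ⟨C + 2 * (k + 1) * (3 / 4 + C) + 4 * (k + 1) ^ 2 * (3 / 4 + C), by positivity,
      fun t ht => ?_⟩
    have h1 := h t ht
    have hr := two_mul_besselReal (k + 1) t
    have e1 : (k : ℤ) + 1 - 1 = k := by ring
    rw [e1] at hr
    push_cast at hr ⊢
    set a := besselReal k t
    set b := besselReal (k + 1) t
    set d := besselReal (k + 1 + 1) t
    have ht0 : 0 < t := by linarith
    have hd : d = 2 * (k + 1) * b / t - a := by
      field_simp
      linarith
    have hCt : C / t ≤ C := div_le_self hC ht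
    have hk : (0 : ℝ) ≤ k + 1 := by positivity
    have hb : b ^ 2 ≤ (3 / 4 + C) / t := by
      rw [le_div_iff₀ ht0]
      nlinarith [sq_nonneg a]
    have hab : -(2 * (a * b)) ≤ (3 / 4 + C) / t := by
      rw [le_div_iff₀ ht0]
      nlinarith [mul_nonneg ht0.le (sq_nonneg (a + b))]
    have hbt : b ^ 2 / t ≤ (3 / 4 + C) / t :=
      (div_le_self (sq_nonneg b) ht).trans hb
    -- Since d = -a + O(b/t), raising the order changes the amplitude only by terms that are O(1/t).
    have hX : t * (b ^ 2 + d ^ 2) = t * (a ^ 2 + b ^ 2) + 2 * (k + 1) * (-(2 * (a * b)))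
        + 4 * (k + 1) ^ 2 * (b ^ 2 / t) := by
      rw [hd]
      field_simp
      ring
    rw [hX]
    have e2 : 3 / 4 + (C + 2 * (k + 1) * (3 / 4 + C) + 4 * (k + 1) ^ 2 * (3 / 4 + C)) / t
        = 3 / 4 + C / t + 2 * (k + 1) * ((3 / 4 + C) / t)
          + 4 * (k + 1) ^ 2 * ((3 / 4 + C) / t) := by
      ring
    rw [e2]
    gcongr

/-! ### The Sonin function and the bound beyond the turning point. -/

/-- The potential of Bessel's equation in Liouville normal form, beyond the turning point;
`c` stands for the squared order and `q` for `t ^ 2 - c`. -/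
def liouvillePotential (c q : ℝ) : ℝ :=
  1 + 1 / (4 * q) + 3 * c / (2 * q ^ 2) + 5 * c ^ 2 / (4 * q ^ 3)

theorem one_le_liouvillePotential {c q : ℝ} (hc : 0 ≤ c) (hq : 0 < q) :
    1 ≤ liouvillePotential c q := by
  have : 0 ≤ 1 / (4 * q) + 3 * c / (2 * q ^ 2) + 5 * c ^ 2 / (4 * q ^ 3) := by positivity
  unfold liouvillePotential
  linarith

theorem hasDerivAt_liouvillePotential (c : ℝ) {q : ℝ} (hq : 0 < q) :
    HasDerivAt (liouvillePotential c)
      (-(1 / (4 * q ^ 2) + 3 * c / q ^ 3 + 15 * c ^ 2 / (4 * q ^ 4))) q := by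
  have h := hasDerivAt_id q
  have h1 := ((hasDerivAt_const q (1 : ℝ)).div (h.const_mul 4) (by simpa using hq.ne'))
  have h2 := ((hasDerivAt_const q (3 * c)).div ((h.pow 2).const_mul 2)
    (by simpa using hq.ne'))
  have h3 := ((hasDerivAt_const q (5 * c ^ 2)).div ((h.pow 3).const_mul 4)
    (by simpa using hq.ne'))
  refine (((h1.const_add 1).add h2).add h3).congr_deriv ?_
  simp only [id, Pi.pow_apply]
  field_simp
  ring

/-- The Sonin function of Bessel's equation in Liouville normal form. -/
def besselSonin (n : ℕ) (t : ℝ) : ℝ :=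
  √(t ^ 2 - n ^ 2) * besselReal n t ^ 2 +
    (t * besselDeriv n t + t ^ 2 * besselReal n t / (2 * (t ^ 2 - n ^ 2))) ^ 2 /
      (√(t ^ 2 - n ^ 2) * liouvillePotential (n ^ 2) (t ^ 2 - n ^ 2))

theorem hasDerivAt_besselSonin (n : ℕ) {t : ℝ} (ht : (n : ℝ) < t) :
    HasDerivAt (besselSonin n)
      ((t * besselDeriv n t + t ^ 2 * besselReal n t / (2 * (t ^ 2 - n ^ 2))) ^ 2 *
        ((1 / (4 * (t ^ 2 - n ^ 2) ^ 2) + 3 * n ^ 2 / (t ^ 2 - n ^ 2) ^ 3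
          + 15 * (n ^ 2) ^ 2 / (4 * (t ^ 2 - n ^ 2) ^ 4)) * (2 * t)) /
        (√(t ^ 2 - n ^ 2) * liouvillePotential (n ^ 2) (t ^ 2 - n ^ 2) ^ 2)) t := by
  have hn : (0 : ℝ) ≤ n := n.cast_nonneg
  have ht0 : 0 < t := hn.trans_lt ht
  have hQ : 0 < t ^ 2 - (n : ℝ) ^ 2 := by nlinarith
  have hw : 0 < √(t ^ 2 - (n : ℝ) ^ 2) := Real.sqrt_pos.mpr hQ
  have hwQ : √(t ^ 2 - (n : ℝ) ^ 2) ^ 2 = t ^ 2 - (n : ℝ) ^ 2 := Real.sq_sqrt hQ.le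
  have dQ : HasDerivAt (fun x : ℝ => x ^ 2 - (n : ℝ) ^ 2) (2 * t) t := by
    simpa using (hasDerivAt_pow 2 t).sub_const ((n : ℝ) ^ 2)
  have dw : HasDerivAt (fun x : ℝ => √(x ^ 2 - (n : ℝ) ^ 2)) (t / √(t ^ 2 - (n : ℝ) ^ 2)) t := by
    refine (dQ.sqrt hQ.ne').congr_deriv ?_
    field_simp
  have dP : HasDerivAt (fun x : ℝ => liouvillePotential ((n : ℝ) ^ 2) (x ^ 2 - (n : ℝ) ^ 2)) _ t :=
    HasDerivAt.comp t (hasDerivAt_liouvillePotential ((n : ℝ) ^ 2) hQ) dQ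
  have dJ : HasDerivAt (besselReal n) (besselDeriv n t) t := hasDerivAt_besselReal n t
  have dY := hasDerivAt_mul_besselDeriv n ht0.ne'
  have dN : HasDerivAt (fun x => x * besselDeriv n x +
      x ^ 2 * besselReal n x / (2 * (x ^ 2 - (n : ℝ) ^ 2)))
      (t / (2 * (t ^ 2 - (n : ℝ) ^ 2)) *
        (t * besselDeriv n t + t ^ 2 * besselReal n t / (2 * (t ^ 2 - (n : ℝ) ^ 2)))
        - (t ^ 2 - (n : ℝ) ^ 2) / t *
          liouvillePotential ((n : ℝ) ^ 2) (t ^ 2 - (n : ℝ) ^ 2) * besselReal n t) t := by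
    refine (dY.add (((hasDerivAt_pow 2 t).mul dJ).div (dQ.const_mul 2)
      (by positivity))).congr_deriv ?_
    unfold liouvillePotential
    -- Eliminating n² in favour of q leaves a rational identity in t and q.
    obtain ⟨q, hq⟩ : ∃ q, q = t ^ 2 - (n : ℝ) ^ 2 := ⟨_, rfl⟩
    have hn2 : (n : ℝ) ^ 2 = t ^ 2 - q := by linarith
    rw [← hq] at hQ ⊢
    simp only [Pi.mul_apply, Int.cast_natCast, hn2]
    field_simp
    ring
  have hP : 0 < liouvillePotential ((n : ℝ) ^ 2) (t ^ 2 - (n : ℝ) ^ 2) :=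
    one_pos.trans_le (one_le_liouvillePotential (by positivity) hQ)
  refine ((dw.mul (dJ.pow 2)).add ((dN.pow 2).div (dw.mul dP)
    (mul_pos hw hP).ne')).congr_deriv ?_
  simp only [Pi.mul_apply, Pi.pow_apply, Nat.reduceSub, pow_one]
  generalize liouvillePotential ((n : ℝ) ^ 2) (t ^ 2 - (n : ℝ) ^ 2) = P at *
  generalize √(t ^ 2 - (n : ℝ) ^ 2) = w at *
  rw [← hwQ]
  generalize hD : -(1 / (4 * (w ^ 2) ^ 2) + 3 * (n : ℝ) ^ 2 / (w ^ 2) ^ 3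
    + 15 * ((n : ℝ) ^ 2) ^ 2 / (4 * (w ^ 2) ^ 4)) = D
  have hD' : 1 / (4 * (w ^ 2) ^ 2) + 3 * (n : ℝ) ^ 2 / (w ^ 2) ^ 3
    + 15 * ((n : ℝ) ^ 2) ^ 2 / (4 * (w ^ 2) ^ 4) = -D := by linarith
  rw [hD']
  have hw0 := hw.ne'
  have hP0 := hP.ne'
  field_simp
  ring

/-- For u'' + P u = 0 one has (u² + u'²/P)' = -u'² P'/P², and here P decreases. -/
theorem monotoneOn_besselSonin (n : ℕ) : MonotoneOn (besselSonin n) (Set.Ioi (n : ℝ)) := by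
  refine monotoneOn_of_deriv_nonneg (convex_Ioi _) ?_ ?_ ?_
  · intro x hx
    exact (hasDerivAt_besselSonin n hx).continuousAt.continuousWithinAt
  · intro x hx
    rw [interior_Ioi] at hx
    exact (hasDerivAt_besselSonin n hx).differentiableAt.differentiableWithinAt
  · intro t ht
    rw [interior_Ioi] at ht
    rw [(hasDerivAt_besselSonin n ht).deriv]
    have hn : (0 : ℝ) ≤ n := n.cast_nonneg
    have ht : (n : ℝ) < t := ht
    have ht0 : 0 < t := hn.trans_lt ht
    have hQ : 0 < t ^ 2 - (n : ℝ) ^ 2 := by nlinarith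
    positivity

/-- Bound of the Sonin function far beyond the turning point. -/
theorem exists_besselSonin_le (n : ℕ) : ∃ C : ℝ, 0 ≤ C ∧ ∀ t : ℝ, 1 ≤ t → 2 * n ≤ t →
    besselSonin n t ≤ 3 / 4 + C / t := by
  obtain ⟨C, hC, h⟩ := exists_sq_add_sq_le n
  refine ⟨C + 2 * n ^ 2 * (3 / 4 + C) + 2 * (n + 1) * (3 / 4 + C)
    + 2 * (n + 1) ^ 2 * (3 / 4 + C), by positivity, fun t ht htn => ?_⟩
  have hn : (0 : ℝ) ≤ n := n.cast_nonneg
  have h1 := h t ht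
  have ht0 : 0 < t := by linarith
  have hQ4 : 3 / 4 * t ^ 2 ≤ t ^ 2 - (n : ℝ) ^ 2 := by nlinarith
  have hQ : 0 < t ^ 2 - (n : ℝ) ^ 2 := lt_of_lt_of_le (by positivity) hQ4
  have hw : 0 < √(t ^ 2 - (n : ℝ) ^ 2) := Real.sqrt_pos.mpr hQ
  have hwQ : √(t ^ 2 - (n : ℝ) ^ 2) ^ 2 = t ^ 2 - (n : ℝ) ^ 2 := Real.sq_sqrt hQ.le
  have hP := one_le_liouvillePotential (sq_nonneg (n : ℝ)) hQ
  have hY := mul_besselDeriv n t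
  unfold besselSonin
  rw [hY, Int.cast_natCast]
  set w := √(t ^ 2 - (n : ℝ) ^ 2)
  set P := liouvillePotential ((n : ℝ) ^ 2) (t ^ 2 - (n : ℝ) ^ 2)
  set a := besselReal n t
  set b := besselReal (n + 1) t
  obtain ⟨c, hcdef⟩ : ∃ c, c = n + t ^ 2 / (2 * (t ^ 2 - (n : ℝ) ^ 2)) := ⟨_, rfl⟩
  have hN : n * a - t * b + t ^ 2 * a / (2 * (t ^ 2 - (n : ℝ) ^ 2)) = c * a - t * b := by
    rw [hcdef]; ring
  have hc0 : 0 ≤ c := by rw [hcdef]; positivity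
  have hc1 : c ≤ n + 1 := by
    rw [hcdef]
    gcongr
    rw [div_le_one (by positivity)]
    nlinarith
  have hwt : w ≤ t := by
    refine Real.sqrt_le_iff.mpr ⟨ht0.le, ?_⟩
    linarith [sq_nonneg (n : ℝ)]
  have htw : t ≤ 2 * w := by
    have : t / 2 ≤ w := Real.le_sqrt_of_sq_le (by nlinarith)
    linarith
  have hCt : C / t ≤ C := div_le_self hC ht
  have hta := mul_nonneg ht0.le (sq_nonneg a)
  have htb := mul_nonneg ht0.le (sq_nonneg b)
  have ha : a ^ 2 ≤ (3 / 4 + C) / t := by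
    rw [le_div_iff₀ ht0]
    linarith
  have hb : t * b ^ 2 ≤ 3 / 4 + C := by
    linarith
  have hab : -(2 * (a * b)) ≤ (3 / 4 + C) / t := by
    rw [le_div_iff₀ ht0]
    linarith [mul_nonneg ht0.le (sq_nonneg (a + b))]
  rw [hN]
  have e1 : (c * a - t * b) ^ 2 / (w * P) ≤ (c * a - t * b) ^ 2 / w := by
    refine div_le_div_of_nonneg_left (sq_nonneg _) hw ?_
    exact le_mul_of_one_le_right hw.le hP
  -- The main term t b² completes w a² ≤ t a² to the amplitude of consecutive orders; the other
  -- three terms are bounded by multiples of 1/t.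
  have e2 : (c * a - t * b) ^ 2 / w = t * b ^ 2 + t * b ^ 2 * ((t - w) / w)
      + c * (-(2 * (a * b))) * (t / w) + c ^ 2 * a ^ 2 / w := by
    field_simp
    ring
  have e3 : (t - w) / w ≤ 2 * n ^ 2 / t := by
    rw [div_le_div_iff₀ hw ht0]
    have : (t - w) * (t + w) = n ^ 2 := by linarith
    have h2 : (t - w) * t ≤ (t - w) * (t + w) :=
      mul_le_mul_of_nonneg_left (by linarith) (sub_nonneg.mpr hwt)
    have h3 : (n : ℝ) ^ 2 * 1 ≤ n ^ 2 * (2 * w) :=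
      mul_le_mul_of_nonneg_left (by linarith) (sq_nonneg _)
    linarith
  have e4 : t / w ≤ 2 := by
    rw [div_le_iff₀ hw]
    exact htw
  have e5 : t * b ^ 2 * ((t - w) / w) ≤ (3 / 4 + C) * (2 * n ^ 2 / t) :=
    mul_le_mul hb e3 (div_nonneg (by linarith) hw.le) (by positivity)
  have e6 : c * (-(2 * (a * b))) * (t / w) ≤ (n + 1) * ((3 / 4 + C) / t) * 2 := by
    have hpos : 0 ≤ (3 / 4 + C) / t := by positivity
    calc c * (-(2 * (a * b))) * (t / w) ≤ c * ((3 / 4 + C) / t) * (t / w) := by gcongr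
      _ ≤ (n + 1) * ((3 / 4 + C) / t) * 2 := by gcongr
  have e7 : c ^ 2 * a ^ 2 / w ≤ (n + 1) ^ 2 * ((3 / 4 + C) / t) * 2 := by
    have hw1 : 1 / w ≤ 2 := by
      rw [div_le_iff₀ hw]
      linarith
    calc c ^ 2 * a ^ 2 / w = c ^ 2 * a ^ 2 * (1 / w) := by ring
      _ ≤ (n + 1) ^ 2 * ((3 / 4 + C) / t) * 2 := by gcongr
  have e8 : w * a ^ 2 ≤ t * a ^ 2 := by gcongr
  have e9 : 3 / 4 + (C + 2 * n ^ 2 * (3 / 4 + C) + 2 * (n + 1) * (3 / 4 + C)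
    + 2 * (n + 1) ^ 2 * (3 / 4 + C)) / t = (3 / 4 + C / t) + (3 / 4 + C) * (2 * n ^ 2 / t)
      + (n + 1) * ((3 / 4 + C) / t) * 2 + (n + 1) ^ 2 * ((3 / 4 + C) / t) * 2 := by
    ring
  rw [e9]
  linarith

/-- The left side is one summand of an increasing function that is eventually at most 3/4 + C/t. -/
theorem sqrt_mul_besselReal_sq_le (n : ℕ) {t : ℝ} (ht : (n : ℝ) < t) :
    √(t ^ 2 - n ^ 2) * besselReal n t ^ 2 ≤ 3 / 4 := by
  have hn : (0 : ℝ) ≤ n := n.cast_nonneg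
  have ht0 : 0 < t := hn.trans_lt ht
  have hQ : 0 < t ^ 2 - (n : ℝ) ^ 2 := by nlinarith
  obtain ⟨C, hC, h⟩ := exists_besselSonin_le n
  have h1 : √(t ^ 2 - n ^ 2) * besselReal n t ^ 2 ≤ besselSonin n t := by
    have := one_pos.trans_le (one_le_liouvillePotential (sq_nonneg (n : ℝ)) hQ)
    unfold besselSonin
    refine le_add_of_nonneg_right ?_
    positivity
  refine h1.trans ?_
  have hlim : Filter.Tendsto (fun x : ℝ => 3 / 4 + C / x) Filter.atTop (nhds (3 / 4 + 0)) :=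
    (Filter.Tendsto.const_div_atTop Filter.tendsto_id C).const_add _
  rw [add_zero] at hlim
  refine ge_of_tendsto hlim ?_
  filter_upwards [Filter.eventually_ge_atTop t, Filter.eventually_ge_atTop 1,
    Filter.eventually_ge_atTop (2 * (n : ℝ))] with x hx hx1 hx2
  exact (monotoneOn_besselSonin n ht (ht.trans_le hx) hx).trans (h x hx1 hx2)

/-! ### Monotonicity before the turning point. -/

/-- The difference of the two sides vanishes at 0 and has derivative 2t J_n². It gives a lower bound
for the logarithmic derivative of J_n. -/
theorem sub_sq_mul_besselReal_sq_le {n : ℕ} (hn : n ≠ 0) {t : ℝ} (ht : 0 ≤ t) :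
    ((n : ℝ) ^ 2 - t ^ 2) * besselReal n t ^ 2 ≤ (t * besselDeriv n t) ^ 2 := by
  set G : ℝ → ℝ := fun x => (x * besselDeriv n x) ^ 2
    - ((n : ℝ) ^ 2 - x ^ 2) * besselReal n x ^ 2 with hG
  have hmono : MonotoneOn G (Set.Ici 0) := by
    have hd : ∀ x : ℝ, 0 < x → HasDerivAt G (2 * x * besselReal n x ^ 2) x := by
      intro x hx
      have dJ : HasDerivAt (besselReal n) (besselDeriv n x) x := hasDerivAt_besselReal n x
      refine (((hasDerivAt_mul_besselDeriv n hx.ne').pow 2).sub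
        (((hasDerivAt_pow 2 x).const_sub ((n : ℝ) ^ 2)).mul (dJ.pow 2))).congr_deriv ?_
      simp only [Pi.pow_apply, Nat.reduceSub, pow_one, Int.cast_natCast]
      field_simp
      push_cast
      ring
    refine monotoneOn_of_deriv_nonneg (convex_Ici _) ?_ ?_ ?_
    · have h1 := continuous_besselReal n
      have h2 := continuous_besselDeriv n
      exact (by fun_prop : Continuous G).continuousOn
    · intro x hx
      rw [interior_Ici] at hx
      exact (hd x hx).differentiableAt.differentiableWithinAt
    · intro x hx
      rw [interior_Ici] at hx
      rw [(hd x hx).deriv]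
      have : 0 < x := hx
      positivity
  have h0 : G 0 = 0 := by
    have : besselReal n 0 = 0 := besselReal_zero_right (by exact_mod_cast hn)
    simp [hG, this]
  have := hmono Set.self_mem_Ici ht ht
  rw [h0] at this
  simp only [hG] at this
  linarith

/-- The product vanishes at 0, and by Bessel's equation its derivative is a sum of nonnegative terms
while t ≤ n. -/
theorem mul_besselDeriv_mul_besselReal_nonneg (n : ℕ) {t : ℝ} (ht : 0 ≤ t) (htn : t ≤ n) :
    0 ≤ t * besselDeriv n t * besselReal n t := by
  set H : ℝ → ℝ := fun x => x * besselDeriv n x * besselReal n x with hH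
  have hmono : MonotoneOn H (Set.Icc 0 n) := by
    have hd : ∀ x : ℝ, 0 < x → HasDerivAt H
        (((n : ℝ) ^ 2 - x ^ 2) / x * besselReal n x ^ 2 + x * besselDeriv n x ^ 2) x := by
      intro x hx
      have dJ : HasDerivAt (besselReal n) (besselDeriv n x) x := hasDerivAt_besselReal n x
      refine ((hasDerivAt_mul_besselDeriv n hx.ne').mul dJ).congr_deriv ?_
      rw [Int.cast_natCast]
      ring
    refine monotoneOn_of_deriv_nonneg (convex_Icc _ _) ?_ ?_ ?_
    · have h1 := continuous_besselReal n
      have h2 := continuous_besselDeriv n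
      exact (by fun_prop : Continuous H).continuousOn
    · intro x hx
      rw [interior_Icc] at hx
      exact (hd x hx.1).differentiableAt.differentiableWithinAt
    · intro x hx
      rw [interior_Icc] at hx
      rw [(hd x hx.1).deriv]
      have h0 := hx.1
      have h1 : 0 ≤ (n : ℝ) ^ 2 - x ^ 2 := by nlinarith [hx.2]
      positivity
  have h0 : H 0 = 0 := by simp [hH]
  have := hmono (Set.left_mem_Icc.mpr (ht.trans htn)) ⟨ht, htn⟩ ht
  rwa [h0] at this

theorem monotoneOn_besselReal_sq (n : ℕ) :
    MonotoneOn (fun t => besselReal n t ^ 2) (Set.Icc 0 (n : ℝ)) := by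
  have hd : ∀ x : ℝ, HasDerivAt (fun t => besselReal n t ^ 2)
      (2 * besselReal n x * besselDeriv n x) x := by
    intro x
    have dJ : HasDerivAt (besselReal n) (besselDeriv n x) x := hasDerivAt_besselReal n x
    exact (dJ.pow 2).congr_deriv (by norm_num)
  refine monotoneOn_of_deriv_nonneg (convex_Icc _ _) ?_ ?_ ?_
  · exact fun x _ => (hd x).continuousAt.continuousWithinAt
  · exact fun x _ => (hd x).differentiableAt.differentiableWithinAt
  · intro x hx
    rw [interior_Icc] at hx
    rw [(hd x).deriv]
    have h := mul_besselDeriv_mul_besselReal_nonneg n hx.1.le hx.2.le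
    have : 0 ≤ x * (2 * besselReal n x * besselDeriv n x) := by linarith
    exact nonneg_of_mul_nonneg_right this hx.1

/-! ### The bound at the turning point. -/

/-- From t ≥ n + m/2 follows t² - n² ≥ nm = m⁴. -/
theorem mul_besselReal_sq_le_of_le {n : ℕ} {m t : ℝ} (hm : 0 < m) (hmn : m ^ 3 = n)
    (ht : n + m / 2 ≤ t) : m ^ 2 * besselReal n t ^ 2 ≤ 3 / 4 := by
  have hn : (0 : ℝ) < n := hmn ▸ by positivity
  refine le_trans ?_ (sqrt_mul_besselReal_sq_le n (by linarith : (n : ℝ) < t))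
  refine mul_le_mul_of_nonneg_right (Real.le_sqrt_of_sq_le ?_) (sq_nonneg _)
  have h1 : (n + m / 2) ^ 2 ≤ t ^ 2 := by gcongr
  have h2 : (m ^ 2) ^ 2 = n * m := by rw [← hmn]; ring
  nlinarith [sq_nonneg m]

/-- A solution of Bessel's equation does not fall much after a local maximum close to the
turning point. -/
theorem maximum_le_near_turning_point {n m M z : ℝ} {y Y : ℝ → ℝ} (hm : 0 < m) (hmn : m ^ 3 = n)
    (hM : 0 ≤ M)
    (hz : n ≤ z) (hz1 : z ≤ n + m / 2) (hy : ∀ x, 0 < x → HasDerivAt y (Y x / x) x)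
    (hY : ∀ x, 0 < x → HasDerivAt Y ((n ^ 2 - x ^ 2) / x * y x) x)
    (hyM : ∀ x ∈ Set.Icc z (n + m / 2), y x ≤ M) (hyz : y z = M) (hYz : Y z = 0) :
    23 / 24 * M ≤ y (n + m / 2) := by
  have hn : 0 < n := hmn ▸ by positivity
  have hpos : ∀ x ∈ Set.Icc z (n + m / 2), 0 < x := fun x hx => by linarith [hx.1]
  -- Y' ≥ -2M(x - n) gives Y ≥ -M(x - n)²; integrating y' = Y/x once more, y loses at most
  -- M(m/2)³/(3n) = M/24.
  have m1 : MonotoneOn (fun x => Y x + M * (x - n) ^ 2) (Set.Icc z (n + m / 2)) := by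
    have hd : ∀ x ∈ Set.Icc z (n + m / 2), HasDerivAt (fun x => Y x + M * (x - n) ^ 2)
        ((n ^ 2 - x ^ 2) / x * y x + M * (2 * (x - n))) x := by
      intro x hx
      refine ((hY x (hpos x hx)).add
        ((((hasDerivAt_id x).sub_const n).pow 2).const_mul M)).congr_deriv ?_
      simp
    refine monotoneOn_of_deriv_nonneg (convex_Icc _ _) ?_ ?_ ?_
    · exact fun x hx => (hd x hx).continuousAt.continuousWithinAt
    · exact fun x hx => (hd x (interior_subset hx)).differentiableAt.differentiableWithinAt
    · intro x hx
      have hx := interior_subset hx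
      rw [(hd x hx).deriv]
      have hx0 := hpos x hx
      have hxn : n ≤ x := hz.trans hx.1
      have h1 : (x ^ 2 - n ^ 2) / x ≤ 2 * (x - n) := by
        rw [div_le_iff₀ hx0]
        nlinarith
      have h2 : (x ^ 2 - n ^ 2) / x * y x ≤ 2 * (x - n) * M :=
        (mul_le_mul_of_nonneg_left (hyM x hx) (div_nonneg (by nlinarith) hx0.le)).trans
          (mul_le_mul_of_nonneg_right h1 hM)
      have h3 : (n ^ 2 - x ^ 2) / x * y x = -((x ^ 2 - n ^ 2) / x * y x) := by ring
      linarith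
  have m2 : MonotoneOn (fun x => y x + M * (x - n) ^ 3 / (3 * n)) (Set.Icc z (n + m / 2)) := by
    have hd : ∀ x ∈ Set.Icc z (n + m / 2), HasDerivAt (fun x => y x + M * (x - n) ^ 3 / (3 * n))
        (Y x / x + M * (x - n) ^ 2 / n) x := by
      intro x hx
      refine ((hy x (hpos x hx)).add
        (((((hasDerivAt_id x).sub_const n).pow 3).const_mul M).div_const (3 * n))).congr_deriv ?_
      simp only [id]
      field_simp
      push_cast
      ring
    refine monotoneOn_of_deriv_nonneg (convex_Icc _ _) ?_ ?_ ?_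
    · exact fun x hx => (hd x hx).continuousAt.continuousWithinAt
    · exact fun x hx => (hd x (interior_subset hx)).differentiableAt.differentiableWithinAt
    · intro x hx
      have hx := interior_subset hx
      rw [(hd x hx).deriv]
      have hx0 := hpos x hx
      have hxn : n ≤ x := hz.trans hx.1
      have h1 := m1 (Set.left_mem_Icc.mpr hz1) hx hx.1
      simp only [hYz] at h1
      have h2 : 0 ≤ M * (z - n) ^ 2 := by positivity
      have h3 : -(M * (x - n) ^ 2) / x ≤ Y x / x := by
        gcongr
        linarith
      have h4 : M * (x - n) ^ 2 / x ≤ M * (x - n) ^ 2 / n := by gcongr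
      have h5 : -(M * (x - n) ^ 2) / x = -(M * (x - n) ^ 2 / x) := by ring
      linarith
  have h1 := m2 (Set.left_mem_Icc.mpr hz1) (Set.right_mem_Icc.mpr hz1) hz1
  simp only [hyz] at h1
  have h2 : 0 ≤ M * (z - n) ^ 3 / (3 * n) := by
    have := sub_nonneg.mpr hz
    positivity
  have h3 : M * (n + m / 2 - n) ^ 3 / (3 * n) = M / 24 := by
    rw [← hmn]
    field_simp
    ring
  linarith

/-- The uniform bound of order `n ^ (-1 / 3)`. -/
theorem mul_besselReal_sq_le {n : ℕ} {m t : ℝ} (hm : 0 < m) (hmn : m ^ 3 = n) (ht : 0 ≤ t) :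
    m ^ 2 * besselReal n t ^ 2 ≤ 3 / 4 * (24 / 23) ^ 2 := by
  have hn : (0 : ℝ) < n := hmn ▸ by positivity
  rcases le_or_gt (n + m / 2) t with h | h
  · exact (mul_besselReal_sq_le_of_le hm hmn h).trans (by norm_num)
  have hend := mul_besselReal_sq_le_of_le hm hmn le_rfl
  obtain ⟨z₀, hz₀, hmax₀⟩ := isCompact_Icc.exists_isMaxOn (Set.nonempty_Icc.mpr (ht.trans h.le))
    ((continuous_besselReal n).pow 2).continuousOn
  -- J_n² increases on [0, n], so a maximum point can be taken at or beyond n.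
  obtain ⟨z, hz, hzn, hmax⟩ : ∃ z ∈ Set.Icc 0 (n + m / 2), (n : ℝ) ≤ z ∧
      ∀ x ∈ Set.Icc 0 (n + m / 2), besselReal n x ^ 2 ≤ besselReal n z ^ 2 := by
    rcases le_total (n : ℝ) z₀ with h0 | h0
    · exact ⟨z₀, hz₀, h0, fun x hx => hmax₀ hx⟩
    · refine ⟨n, ⟨hn.le, by linarith⟩, le_rfl, fun x hx => (hmax₀ hx).trans ?_⟩
      exact monotoneOn_besselReal_sq n ⟨hz₀.1, h0⟩ ⟨hn.le, le_rfl⟩ h0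
  suffices hs : (23 / 24) ^ 2 * besselReal n z ^ 2 ≤ besselReal n (n + m / 2) ^ 2 by
    have h1 := hmax t ⟨ht, h.le⟩
    nlinarith [sq_nonneg m]
  rcases eq_or_lt_of_le hz.2 with he | hlt
  · rw [← he]
    nlinarith [sq_nonneg (besselReal n z)]
  have hlm : IsLocalMax (fun x => besselReal n x ^ 2) z := by
    filter_upwards [Icc_mem_nhds (hn.trans_le hzn) hlt] with x hx
    exact hmax x hx
  have hcrit : besselReal n z * besselDeriv n z = 0 := by
    have dJ : HasDerivAt (besselReal n) (besselDeriv n z) z := hasDerivAt_besselReal n z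
    have := hlm.hasDerivAt_eq_zero (dJ.pow 2)
    norm_num at this
    exact mul_eq_zero.mpr this
  rcases eq_or_ne (besselReal n z) 0 with h0 | h0
  · rw [h0]
    nlinarith [sq_nonneg (besselReal n (n + m / 2))]
  have hcrit' : besselDeriv n z = 0 := (mul_eq_zero.mp hcrit).resolve_left h0
  -- A sign making the extremum a positive maximum.
  obtain ⟨σ, hσ, hσM⟩ : ∃ σ : ℝ, σ ^ 2 = 1 ∧ σ * besselReal n z = |besselReal n z| := by
    rcases le_total 0 (besselReal n z) with h | h
    · exact ⟨1, by norm_num, by rw [abs_of_nonneg h, one_mul]⟩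
    · exact ⟨-1, by norm_num, by rw [abs_of_nonpos h]; ring⟩
  have key := maximum_le_near_turning_point (M := |besselReal n z|) (z := z)
    (y := fun x => σ * besselReal n x) (Y := fun x => σ * (x * besselDeriv n x)) hm hmn
    (abs_nonneg _) hzn hlt.le
    (fun x hx => ((hasDerivAt_besselReal n x).const_mul σ).congr_deriv (by
      change σ * besselDeriv n x = _
      field_simp))
    (fun x hx => ((hasDerivAt_mul_besselDeriv n hx.ne').const_mul σ).congr_deriv (by
      rw [Int.cast_natCast]
      ring))
    (fun x hx => by
      have h1 := sq_le_sq.mp (hmax x ⟨hz.1.trans hx.1, hx.2⟩)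
      refine (le_abs_self _).trans ?_
      have h2 : |σ| = 1 := by
        rw [← sq_eq_sq₀ (abs_nonneg _) zero_le_one, sq_abs, hσ, one_pow]
      rwa [abs_mul, h2, one_mul])
    hσM (by simp [hcrit'])
  calc (23 / 24) ^ 2 * besselReal n z ^ 2 = (23 / 24 * |besselReal n z|) ^ 2 := by
        rw [mul_pow, sq_abs]
    _ ≤ (σ * besselReal n (n + m / 2)) ^ 2 := by gcongr
    _ = besselReal n (n + m / 2) ^ 2 := by rw [mul_pow, hσ, one_mul]

/-! ### Fourth-power bounds on both sides of the turning point. -/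

theorem mul_besselReal_pow_four_le {n : ℕ} {m t : ℝ} (hm : 0 < m) (hmn : m ^ 3 = n)
    (ht : 0 ≤ t) : m ^ 4 * besselReal n t ^ 4 ≤ 7 / 10 := by
  have h := mul_besselReal_sq_le hm hmn ht
  have h0 : 0 ≤ m ^ 2 * besselReal n t ^ 2 := by positivity
  nlinarith

/-- The bound before the turning point. -/
theorem sub_sq_mul_besselReal_pow_four_le {n : ℕ} {m t : ℝ} (hm : 0 < m) (hmn : m ^ 3 = n)
    (ht : 0 < t) (htn : t ≤ n) :
    ((n : ℝ) ^ 2 - t ^ 2) * besselReal n t ^ 4 ≤ 9 / 16 := by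
  have hn : (0 : ℝ) < n := hmn ▸ by positivity
  have hn0 : n ≠ 0 := by rintro rfl; simp at hn
  -- The threshold 16/25 is small enough here, as (16/25)(7/10) ≤ 9/16, and large enough for the
  -- monotonicity below, as 2(4/5)³ ≥ 1.
  have hnear : ∀ x : ℝ, 0 ≤ x → (n : ℝ) ^ 2 - x ^ 2 ≤ 16 / 25 * m ^ 4 →
      ((n : ℝ) ^ 2 - x ^ 2) * besselReal n x ^ 4 ≤ 9 / 16 := by
    intro x hx hxm
    have h := mul_besselReal_pow_four_le hm hmn hx
    have h0 : 0 ≤ besselReal n x ^ 4 := by positivity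
    nlinarith
  rcases le_or_gt ((n : ℝ) ^ 2 - t ^ 2) (16 / 25 * m ^ 4) with h | h
  · exact hnear t ht.le h
  have hB : 0 ≤ (n : ℝ) ^ 2 - 16 / 25 * m ^ 4 := by nlinarith [sq_nonneg t]
  set s := √((n : ℝ) ^ 2 - 16 / 25 * m ^ 4) with hs
  have hs2 : s ^ 2 = (n : ℝ) ^ 2 - 16 / 25 * m ^ 4 := Real.sq_sqrt hB
  have hts : t ≤ s := Real.le_sqrt_of_sq_le (by linarith)
  refine le_trans ?_ (hnear s (ht.le.trans hts) (by linarith))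
  set D : ℝ → ℝ := fun x => ((n : ℝ) ^ 2 - x ^ 2) * besselReal n x ^ 4 with hD
  have hd : ∀ x : ℝ, HasDerivAt D (besselReal n x ^ 2 * (4 * ((n : ℝ) ^ 2 - x ^ 2) *
      (besselDeriv n x * besselReal n x) - 2 * x * besselReal n x ^ 2)) x := by
    intro x
    have dJ : HasDerivAt (besselReal n) (besselDeriv n x) x := hasDerivAt_besselReal n x
    refine (((hasDerivAt_pow 2 x).const_sub ((n : ℝ) ^ 2)).mul (dJ.pow 4)).congr_deriv ?_
    simp only [Pi.pow_apply, Nat.reduceSub, pow_one]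
    push_cast
    ring
  have hmono : MonotoneOn D (Set.Icc t s) := by
    refine monotoneOn_of_deriv_nonneg (convex_Icc _ _) ?_ ?_ ?_
    · exact fun x _ => (hd x).continuousAt.continuousWithinAt
    · exact fun x _ => (hd x).differentiableAt.differentiableWithinAt
    · intro x hx
      have hx := interior_subset hx
      have hx0 : 0 < x := ht.trans_le hx.1
      have hxs : x ^ 2 ≤ s ^ 2 := by gcongr; exact hx.2
      have hR : 16 / 25 * m ^ 4 ≤ (n : ℝ) ^ 2 - x ^ 2 := by linarith
      have hR0 : 0 ≤ (n : ℝ) ^ 2 - x ^ 2 := le_trans (by positivity) hR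
      have hxn : x ≤ n := by
        refine le_of_sq_le_sq ?_ hn.le
        linarith
      rw [(hd x).deriv]
      refine mul_nonneg (sq_nonneg _) ?_
      set w := √((n : ℝ) ^ 2 - x ^ 2) with hw
      have hw2 : w ^ 2 = (n : ℝ) ^ 2 - x ^ 2 := Real.sq_sqrt hR0
      have hw0 : 0 ≤ w := Real.sqrt_nonneg _
      have hwm : 4 / 5 * m ^ 2 ≤ w := Real.le_sqrt_of_sq_le (by nlinarith)
      have hH := mul_besselDeriv_mul_besselReal_nonneg n hx0.le hxn
      have hG := sub_sq_mul_besselReal_sq_le hn0 hx0.le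
      have h1 : w * besselReal n x ^ 2 ≤ x * besselDeriv n x * besselReal n x := by
        refine le_of_sq_le_sq ?_ hH
        calc (w * besselReal n x ^ 2) ^ 2
            = ((n : ℝ) ^ 2 - x ^ 2) * besselReal n x ^ 2 * besselReal n x ^ 2 := by
              rw [← hw2]; ring
          _ ≤ (x * besselDeriv n x) ^ 2 * besselReal n x ^ 2 := by gcongr
          _ = _ := by ring
      -- With x J' J ≥ w J², this is the condition for 4w² J J' ≥ 2x J²: it holds since w ≥ (4/5)m²
      -- and x² ≤ n² = m⁶.
      have h2 : x ^ 2 ≤ 2 * w ^ 3 := by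
        have h3 : (4 / 5 * m ^ 2) ^ 3 ≤ w ^ 3 := by gcongr
        have h4 : x ^ 2 ≤ (n : ℝ) ^ 2 := by linarith
        have h5 : (n : ℝ) ^ 2 = (m ^ 2) ^ 3 := by rw [← hmn]; ring
        have h6 : 0 ≤ (m ^ 2) ^ 3 := by positivity
        nlinarith
      refine nonneg_of_mul_nonneg_right (a := x) ?_ hx0
      have h3 : 2 * x ^ 2 * besselReal n x ^ 2 ≤ 2 * (2 * w ^ 3) * besselReal n x ^ 2 := by
        gcongr
      have h4 : w ^ 2 * (w * besselReal n x ^ 2)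
          ≤ w ^ 2 * (x * besselDeriv n x * besselReal n x) := by gcongr
      rw [← hw2]
      linarith
  exact hmono ⟨le_rfl, hts⟩ ⟨hts, le_rfl⟩ hts

theorem sq_sub_mul_besselReal_pow_four_le (n : ℕ) {t : ℝ} (ht : (n : ℝ) ≤ t) :
    (t ^ 2 - (n : ℝ) ^ 2) * besselReal n t ^ 4 ≤ 9 / 16 := by
  rcases eq_or_lt_of_le ht with h | h
  · rw [← h]; norm_num
  have hn : (0 : ℝ) ≤ n := n.cast_nonneg
  have hQ : 0 ≤ t ^ 2 - (n : ℝ) ^ 2 := by nlinarith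
  have h1 := sqrt_mul_besselReal_sq_le n h
  have h2 := Real.sq_sqrt hQ
  have h3 : 0 ≤ √(t ^ 2 - (n : ℝ) ^ 2) * besselReal n t ^ 2 := by positivity
  calc (t ^ 2 - (n : ℝ) ^ 2) * besselReal n t ^ 4
      = (√(t ^ 2 - (n : ℝ) ^ 2) * besselReal n t ^ 2) ^ 2 := by rw [mul_pow, h2]; ring
    _ ≤ (3 / 4) ^ 2 := by gcongr
    _ = 9 / 16 := by norm_num

/-! ### Comparison and concatenation of integrals. -/

theorem integrableOn_and_setIntegral_le {f g : ℝ → ℝ} {S : Set ℝ} (hS : MeasurableSet S)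
    (hf : Measurable f) (hf0 : ∀ t ∈ S, 0 ≤ f t) (hfg : ∀ t ∈ S, f t ≤ g t)
    (hg : IntegrableOn g S) : IntegrableOn f S ∧ ∫ t in S, f t ≤ ∫ t in S, g t := by
  have hi : IntegrableOn f S := by
    refine Integrable.mono' hg hf.aestronglyMeasurable ?_
    filter_upwards [ae_restrict_mem hS] with t ht
    rw [Real.norm_of_nonneg (hf0 t ht)]
    exact hfg t ht
  exact ⟨hi, setIntegral_mono_on hi hg hS hfg⟩

theorem integrableOn_Ioc_and_setIntegral_le {f g : ℝ → ℝ} {a b : ℝ} (hab : a ≤ b)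
    (hf : Measurable f) (hf0 : ∀ t ∈ Set.Ioo a b, 0 ≤ f t) (hfg : ∀ t ∈ Set.Ioo a b, f t ≤ g t)
    (hg : IntervalIntegrable g volume a b) :
    IntegrableOn f (Set.Ioc a b) ∧ ∫ t in Set.Ioc a b, f t ≤ ∫ t in a..b, g t := by
  rw [integrableOn_Ioc_iff_integrableOn_Ioo, intervalIntegral.integral_of_le hab,
    integral_Ioc_eq_integral_Ioo, integral_Ioc_eq_integral_Ioo]
  rw [intervalIntegrable_iff_integrableOn_Ioo_of_le hab] at hg
  exact integrableOn_and_setIntegral_le measurableSet_Ioo hf hf0 hfg hg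

theorem integrableOn_union_and_setIntegral_le {f : ℝ → ℝ} {S T : Set ℝ} {A B : ℝ}
    (hST : Disjoint S T) (hT : MeasurableSet T)
    (h₁ : IntegrableOn f S ∧ ∫ t in S, f t ≤ A) (h₂ : IntegrableOn f T ∧ ∫ t in T, f t ≤ B) :
    IntegrableOn f (S ∪ T) ∧ ∫ t in S ∪ T, f t ≤ A + B := by
  refine ⟨h₁.1.union h₂.1, ?_⟩
  rw [setIntegral_union hST hT h₁.1 h₂.1]
  exact add_le_add h₁.2 h₂.2

/-- The integrand, in terms of `s = p / 4`. -/
def besselIntegrand (γ s : ℝ) (n : ℕ) (t : ℝ) : ℝ := t ^ γ * (besselReal n t ^ 4) ^ s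

theorem measurable_besselIntegrand (γ s : ℝ) (n : ℕ) : Measurable (besselIntegrand γ s n) := by
  have := (continuous_besselReal n).measurable
  unfold besselIntegrand
  fun_prop

theorem besselIntegrand_nonneg (γ s : ℝ) (n : ℕ) {t : ℝ} (ht : 0 ≤ t) :
    0 ≤ besselIntegrand γ s n t := by
  unfold besselIntegrand
  positivity

theorem norm_besselJ_rpow_eq (p : ℝ) (n : ℤ) (t : ℝ) :
    ‖besselJ n t‖ ^ p = (besselReal n.natAbs t ^ 4) ^ (p / 4) := by
  have h : ‖besselJ n t‖ = |besselReal n.natAbs t| := by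
    rcases Int.natAbs_eq n with h | h
    · rw [← h, norm_besselJ_eq_abs]
    · conv_lhs => rw [h]
      rw [norm_besselJ_neg, norm_besselJ_eq_abs]
  rw [h, ← Even.pow_abs (by decide : Even 4) (besselReal _ _),
    ← Real.rpow_natCast |besselReal _ _|, ← Real.rpow_mul (abs_nonneg _)]
  congr 1
  push_cast
  ring

/-! ### Estimates of the integrand on the four pieces. -/

section Pieces

variable {γ s δ : ℝ} {n : ℕ}

/-- Uses n² - t² ≥ n(n - t) and t^γ ≤ n^γ. -/
theorem besselIntegrand_le_before (hγ : 0 ≤ γ) (hs : 0 ≤ s) {t : ℝ} (ht : 0 < t) (htn : t < n) :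
    besselIntegrand γ s n t ≤ (9 / 16) ^ s * (n : ℝ) ^ (γ - s) * ((n : ℝ) - t) ^ (-s) := by
  have hN : (0 : ℝ) < n := ht.trans htn
  have hNt : 0 < (n : ℝ) - t := sub_pos.mpr htn
  obtain ⟨m, hm, hmn⟩ : ∃ m : ℝ, 0 < m ∧ m ^ 3 = n := by
    refine ⟨(n : ℝ) ^ ((1 : ℝ) / 3), by positivity, ?_⟩
    rw [← Real.rpow_natCast, ← Real.rpow_mul hN.le]
    norm_num
  have h := sub_sq_mul_besselReal_pow_four_le hm hmn ht htn.le
  have hJ : besselReal n t ^ 4 ≤ 9 / 16 * ((n : ℝ)⁻¹ * ((n : ℝ) - t)⁻¹) := by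
    rw [← mul_inv, ← div_eq_mul_inv, le_div_iff₀ (by positivity), mul_comm]
    refine le_trans (mul_le_mul_of_nonneg_right ?_ (by positivity)) h
    nlinarith
  calc besselIntegrand γ s n t
      ≤ (n : ℝ) ^ γ * (9 / 16 * ((n : ℝ)⁻¹ * ((n : ℝ) - t)⁻¹)) ^ s := by
        unfold besselIntegrand; gcongr
    _ = _ := by
        rw [Real.mul_rpow (by norm_num) (by positivity), Real.mul_rpow (by positivity)
          (by positivity), Real.inv_rpow hN.le, Real.inv_rpow hNt.le, Real.rpow_neg hNt.le,
          Real.rpow_sub hN]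
        ring

/-- Uses t² - n² ≥ 2n(t - n) and t^γ ≤ (2n)^γ; the resulting factor 2^(γ - s) is at most 1. -/
theorem besselIntegrand_le_after (hγ : 0 ≤ γ) (hγs : γ ≤ s) (hn : n ≠ 0)
    {t : ℝ} (htn : (n : ℝ) < t) (ht : t ≤ 2 * n) :
    besselIntegrand γ s n t ≤ (9 / 16) ^ s * (n : ℝ) ^ (γ - s) * (t - (n : ℝ)) ^ (-s) := by
  have hN : (0 : ℝ) < n := by positivity
  have hs : 0 ≤ s := hγ.trans hγs
  have hNt : 0 < t - (n : ℝ) := sub_pos.mpr htn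
  have ht0 : 0 < t := hN.trans htn
  have h := sq_sub_mul_besselReal_pow_four_le n htn.le
  have hJ : besselReal n t ^ 4 ≤ 9 / 16 * ((2 * (n : ℝ))⁻¹ * (t - (n : ℝ))⁻¹) := by
    rw [← mul_inv, ← div_eq_mul_inv, le_div_iff₀ (by positivity), mul_comm]
    refine le_trans (mul_le_mul_of_nonneg_right ?_ (by positivity)) h
    nlinarith
  calc besselIntegrand γ s n t
      ≤ (2 * (n : ℝ)) ^ γ * (9 / 16 * ((2 * (n : ℝ))⁻¹ * (t - (n : ℝ))⁻¹)) ^ s := by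
        unfold besselIntegrand; gcongr
    _ = (9 / 16) ^ s * (2 * (n : ℝ)) ^ (γ - s) * (t - (n : ℝ)) ^ (-s) := by
        rw [Real.mul_rpow (x := 9 / 16) (by norm_num) (by positivity),
          Real.mul_rpow (x := (2 * (n : ℝ))⁻¹) (by positivity) (by positivity), Real.inv_rpow (by positivity),
          Real.inv_rpow hNt.le, Real.rpow_neg hNt.le, Real.rpow_sub (x := 2 * (n : ℝ)) (by positivity)]
        ring
    _ ≤ _ := by
        gcongr (9 / 16) ^ s * ?_ * _
        exact Real.rpow_le_rpow_of_nonpos hN (by linarith) (by linarith)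

theorem besselIntegrand_le_near (hγ : 0 ≤ γ) (hs : 0 ≤ s) (hn : n ≠ 0)
    {t : ℝ} (ht : 0 ≤ t) (htn : t ≤ 2 * n) :
    besselIntegrand γ s n t ≤ (2 * (n : ℝ)) ^ γ * ((7 / 10) ^ s * (n : ℝ) ^ (-(4 * s / 3))) := by
  have hN : (0 : ℝ) < n := by positivity
  set m := (n : ℝ) ^ ((1 : ℝ) / 3) with hm
  have hm0 : 0 < m := by positivity
  have hmn : m ^ 3 = n := by
    rw [hm, ← Real.rpow_natCast, ← Real.rpow_mul hN.le]
    norm_num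
  have hm4 : m ^ 4 = (n : ℝ) ^ ((4 : ℝ) / 3) := by
    rw [hm, ← Real.rpow_natCast, ← Real.rpow_mul hN.le]
    norm_num
  have h := mul_besselReal_pow_four_le hm0 hmn ht
  have hJ : besselReal n t ^ 4 ≤ 7 / 10 * (n : ℝ) ^ (-((4 : ℝ) / 3)) := by
    rw [Real.rpow_neg hN.le, ← hm4, ← div_eq_mul_inv, le_div_iff₀ (by positivity), mul_comm]
    exact h
  calc besselIntegrand γ s n t
      ≤ (2 * (n : ℝ)) ^ γ * (7 / 10 * (n : ℝ) ^ (-((4 : ℝ) / 3))) ^ s := by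
        unfold besselIntegrand; gcongr
    _ = _ := by
        rw [Real.mul_rpow (x := 7 / 10) (by norm_num) (by positivity), ← Real.rpow_mul hN.le]
        ring_nf

theorem besselIntegrand_le_far (hs : 0 ≤ s) {c t : ℝ} (hc : 0 < c) (ht : 0 < t)
    (htn : (n : ℝ) ≤ t) (h : c * t ^ 2 ≤ t ^ 2 - (n : ℝ) ^ 2) :
    besselIntegrand γ s n t ≤ (9 / 16 / c) ^ s * t ^ (γ - 2 * s) := by
  have hb := sq_sub_mul_besselReal_pow_four_le n htn
  have hJ : besselReal n t ^ 4 ≤ 9 / 16 / c * (t ^ 2)⁻¹ := by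
    rw [← div_eq_mul_inv, div_div, le_div_iff₀ (by positivity), mul_comm]
    exact (mul_le_mul_of_nonneg_right h (by positivity)).trans hb
  calc besselIntegrand γ s n t ≤ t ^ γ * (9 / 16 / c * (t ^ 2)⁻¹) ^ s := by
        unfold besselIntegrand; gcongr
    _ = _ := by
        rw [Real.mul_rpow (by positivity) (by positivity), Real.inv_rpow (by positivity),
          ← Real.rpow_natCast, ← Real.rpow_mul ht.le, Real.rpow_sub ht]
        push_cast
        ring

theorem besselIntegrand_far (hs : 1 + γ < 2 * s) (hγ : 0 ≤ γ) {c a : ℝ} (hc : 0 < c) (ha : 0 < a)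
    (han : (n : ℝ) ≤ a) (h : ∀ t, a ≤ t → c * t ^ 2 ≤ t ^ 2 - (n : ℝ) ^ 2) :
    IntegrableOn (besselIntegrand γ s n) (Set.Ioi a) ∧
      ∫ t in Set.Ioi a, besselIntegrand γ s n t ≤
        (9 / 16 / c) ^ s * (a ^ (γ - 2 * s + 1) / (2 * s - γ - 1)) := by
  have hexp : γ - 2 * s < -1 := by linarith
  have hmain := integrableOn_and_setIntegral_le (f := besselIntegrand γ s n)
    (g := fun t => (9 / 16 / c) ^ s * t ^ (γ - 2 * s)) (measurableSet_Ioi (a := a))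
    (measurable_besselIntegrand γ s n)
    (fun t ht => besselIntegrand_nonneg γ s n (ha.le.trans (le_of_lt ht)))
    (fun t ht => besselIntegrand_le_far (by linarith) hc (ha.trans ht)
      (han.trans (le_of_lt ht)) (h t (le_of_lt ht)))
    ((integrableOn_Ioi_rpow_of_lt hexp ha).const_mul _)
  refine ⟨hmain.1, hmain.2.trans (le_of_eq ?_)⟩
  rw [integral_const_mul, integral_Ioi_rpow_of_lt hexp ha]
  congr 1
  rw [neg_div, ← div_neg]
  congr 1
  ring

/-- The splitting of the integral into the parts before, near, after and far beyond the turning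
point. -/
theorem besselIntegrand_integral_le (hγ : 0 ≤ γ) (hγ1 : γ ≤ 1) (hs : 1 + γ < 2 * s) (hn : n ≠ 0)
    (hδ : 0 ≤ δ) (hδn : δ ≤ n)
    (hint : IntervalIntegrable (fun x : ℝ => x ^ (-s)) volume δ n) :
    IntegrableOn (besselIntegrand γ s n) (Set.Ioi 0) ∧
      ∫ t in Set.Ioi 0, besselIntegrand γ s n t ≤
        (9 / 16) ^ s * (n : ℝ) ^ (γ - s) * (∫ x in δ..n, x ^ (-s))
        + 2 * δ * ((2 * (n : ℝ)) ^ γ * ((7 / 10) ^ s * (n : ℝ) ^ (-(4 * s / 3))))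
        + (9 / 16) ^ s * (n : ℝ) ^ (γ - s) * (∫ x in δ..n, x ^ (-s))
        + (3 / 4) ^ s * ((2 * (n : ℝ)) ^ (γ - 2 * s + 1) / (2 * s - γ - 1)) := by
  have hN : (0 : ℝ) < n := by positivity
  have hs0 : 0 ≤ s := by linarith
  have hγs : γ ≤ s := by linarith
  have hm := measurable_besselIntegrand γ s n
  have h₁ : IntegrableOn (besselIntegrand γ s n) (Set.Ioc 0 (n - δ)) ∧
      ∫ t in Set.Ioc 0 (n - δ), besselIntegrand γ s n t ≤
        (9 / 16) ^ s * (n : ℝ) ^ (γ - s) * (∫ x in δ..n, x ^ (-s)) := by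
    have hi : IntervalIntegrable (fun t : ℝ => ((n : ℝ) - t) ^ (-s)) volume 0 (n - δ) := by
      have := (hint.comp_sub_left n).symm
      simpa using this
    have h := integrableOn_Ioc_and_setIntegral_le (sub_nonneg.mpr hδn) hm
      (fun t ht => besselIntegrand_nonneg γ s n ht.1.le)
      (fun t ht => besselIntegrand_le_before hγ hs0 ht.1 (ht.2.trans_le (by linarith)))
      (hi.const_mul _)
    refine ⟨h.1, h.2.trans (le_of_eq ?_)⟩
    rw [intervalIntegral.integral_const_mul,
      intervalIntegral.integral_comp_sub_left (fun x : ℝ => x ^ (-s))]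
    simp
  have h₂ : IntegrableOn (besselIntegrand γ s n) (Set.Ioc (n - δ) (n + δ)) ∧
      ∫ t in Set.Ioc (n - δ) (n + δ), besselIntegrand γ s n t ≤
        2 * δ * ((2 * (n : ℝ)) ^ γ * ((7 / 10) ^ s * (n : ℝ) ^ (-(4 * s / 3)))) := by
    have h := integrableOn_Ioc_and_setIntegral_le (by linarith : (n : ℝ) - δ ≤ n + δ) hm
      (fun t ht => besselIntegrand_nonneg γ s n (by linarith [ht.1]))
      (fun t ht => besselIntegrand_le_near hγ hs0 hn (by linarith [ht.1]) (by linarith [ht.2]))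
      intervalIntegrable_const
    refine ⟨h.1, h.2.trans (le_of_eq ?_)⟩
    rw [intervalIntegral.integral_const, smul_eq_mul]
    ring
  have h₃ : IntegrableOn (besselIntegrand γ s n) (Set.Ioc (n + δ) (2 * n)) ∧
      ∫ t in Set.Ioc (n + δ) (2 * n), besselIntegrand γ s n t ≤
        (9 / 16) ^ s * (n : ℝ) ^ (γ - s) * (∫ x in δ..n, x ^ (-s)) := by
    have hi : IntervalIntegrable (fun t : ℝ => (t - (n : ℝ)) ^ (-s)) volume (n + δ) (2 * n) := by
      have := hint.comp_sub_right n
      rwa [add_comm δ, ← two_mul] at this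
    have h := integrableOn_Ioc_and_setIntegral_le (by linarith : (n : ℝ) + δ ≤ 2 * n) hm
      (fun t ht => besselIntegrand_nonneg γ s n (by linarith [ht.1]))
      (fun t ht => besselIntegrand_le_after hγ hγs hn (by linarith [ht.1]) ht.2.le)
      (hi.const_mul _)
    refine ⟨h.1, h.2.trans (le_of_eq ?_)⟩
    rw [intervalIntegral.integral_const_mul,
      intervalIntegral.integral_comp_sub_right (fun x : ℝ => x ^ (-s))]
    congr 2 <;> ring
  have h₄ : IntegrableOn (besselIntegrand γ s n) (Set.Ioi (2 * n)) ∧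
      ∫ t in Set.Ioi (2 * (n : ℝ)), besselIntegrand γ s n t ≤
        (3 / 4) ^ s * ((2 * (n : ℝ)) ^ (γ - 2 * s + 1) / (2 * s - γ - 1)) := by
    -- For t ≥ 2n, t² - n² ≥ (3/4)t², and (9/16)/(3/4) = 3/4.
    have h := besselIntegrand_far (n := n) (c := 3 / 4) (a := 2 * n) hs hγ (by norm_num)
      (by positivity) (by linarith) (fun t ht => by nlinarith)
    norm_num at h
    exact h
  have hu₁ : Set.Ioc 0 ((n : ℝ) - δ) ∪ Set.Ioc (n - δ) (n + δ) = Set.Ioc 0 (n + δ) :=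
    Set.Ioc_union_Ioc_eq_Ioc (by linarith) (by linarith)
  have hu₂ : Set.Ioc 0 ((n : ℝ) + δ) ∪ Set.Ioc (n + δ) (2 * n) = Set.Ioc 0 (2 * (n : ℝ)) :=
    Set.Ioc_union_Ioc_eq_Ioc (by linarith) (by linarith)
  have hu₃ : Set.Ioc 0 (2 * (n : ℝ)) ∪ Set.Ioi (2 * n) = Set.Ioi 0 :=
    Set.Ioc_union_Ioi_eq_Ioi (by linarith)
  have h₁₂ := integrableOn_union_and_setIntegral_le (Set.Ioc_disjoint_Ioc_of_le le_rfl)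
    measurableSet_Ioc h₁ h₂
  rw [hu₁] at h₁₂
  have h₁₃ := integrableOn_union_and_setIntegral_le (Set.Ioc_disjoint_Ioc_of_le le_rfl)
    measurableSet_Ioc h₁₂ h₃
  rw [hu₂] at h₁₃
  have h₁₄ := integrableOn_union_and_setIntegral_le (Set.Ioc_disjoint_Ioi le_rfl)
    measurableSet_Ioi h₁₃ h₄
  rwa [hu₃] at h₁₄

end Pieces

/-! ### The ranges of p and the constants. -/

section Cases

variable {γ s : ℝ} {n : ℕ}

/-- Here x^(-s) is integrable at 0, so δ = 0 and the middle piece disappears. -/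
theorem besselIntegrand_integral_le_of_lt_one (hγ : 0 ≤ γ) (hγ1 : γ ≤ 1) (hs : 1 + γ < 2 * s)
    (hs1 : s < 1) (hn : n ≠ 0) :
    IntegrableOn (besselIntegrand γ s n) (Set.Ioi 0) ∧
      ∫ t in Set.Ioi 0, besselIntegrand γ s n t ≤
        8 * (1 / (4 * s - 2 - 2 * γ) + 1 / (4 - 4 * s)) * (n : ℝ) ^ (γ - 2 * s + 1) := by
  have hN : (0 : ℝ) < n := by positivity
  have hs0 : 0 ≤ s := by linarith
  have h1 : -1 < -s := by linarith
  obtain ⟨hi, h⟩ := besselIntegrand_integral_le hγ hγ1 hs hn le_rfl hN.le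
    (intervalIntegral.intervalIntegrable_rpow' h1)
  refine ⟨hi, h.trans ?_⟩
  rw [integral_rpow (Or.inl h1), Real.zero_rpow (by linarith), sub_zero, mul_zero, zero_mul]
  have e1 : (n : ℝ) ^ (γ - s) * ((n : ℝ) ^ (-s + 1) / (-s + 1))
      = (n : ℝ) ^ (γ - 2 * s + 1) / (1 - s) := by
    rw [← mul_div_assoc, ← Real.rpow_add hN]
    congr 1 <;> ring_nf
  have hA : 0 ≤ (n : ℝ) ^ (γ - 2 * s + 1) := by positivity
  have e2 : (2 * (n : ℝ)) ^ (γ - 2 * s + 1) ≤ (n : ℝ) ^ (γ - 2 * s + 1) :=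
    Real.rpow_le_rpow_of_nonpos hN (by linarith) (by linarith)
  have e3 : ((9 : ℝ) / 16) ^ s ≤ 1 := Real.rpow_le_one (by norm_num) (by norm_num) hs0
  have e4 : ((3 : ℝ) / 4) ^ s ≤ 1 := Real.rpow_le_one (by norm_num) (by norm_num) hs0
  have hd : 0 < 2 * s - γ - 1 := by linarith
  have hd' : 0 < 1 - s := by linarith
  have e5 : (9 / 16) ^ s * ((n : ℝ) ^ (γ - 2 * s + 1) / (1 - s))
      ≤ (n : ℝ) ^ (γ - 2 * s + 1) / (1 - s) := mul_le_of_le_one_left (by positivity) e3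
  have e6 : (3 / 4) ^ s * ((2 * (n : ℝ)) ^ (γ - 2 * s + 1) / (2 * s - γ - 1))
      ≤ (n : ℝ) ^ (γ - 2 * s + 1) / (2 * s - γ - 1) :=
    (mul_le_of_le_one_left (by positivity) e4).trans (by gcongr)
  rw [mul_assoc, e1]
  have e7 : 8 * (1 / (4 * s - 2 - 2 * γ) + 1 / (4 - 4 * s)) * (n : ℝ) ^ (γ - 2 * s + 1)
      = 4 * ((n : ℝ) ^ (γ - 2 * s + 1) / (2 * s - γ - 1))
        + 2 * ((n : ℝ) ^ (γ - 2 * s + 1) / (1 - s)) := by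
    rw [show 4 * s - 2 - 2 * γ = 2 * (2 * s - γ - 1) by ring,
      show 4 - 4 * s = 4 * (1 - s) by ring]
    field_simp
    ring
  rw [e7]
  have h8 : 0 ≤ (n : ℝ) ^ (γ - 2 * s + 1) / (2 * s - γ - 1) := by positivity
  linarith

/-- With δ = n^(1/3), each side piece contributes ∫ dx/x = (2/3) log n, which is the source of the
logarithm. -/
theorem besselIntegrand_integral_le_one (hγ : 0 ≤ γ) (hγ1 : γ < 1) (hn : n ≠ 0) :
    IntegrableOn (besselIntegrand γ 1 n) (Set.Ioi 0) ∧
      ∫ t in Set.Ioi 0, besselIntegrand γ 1 n t ≤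
        4 / (1 - γ) * ((n : ℝ) ^ (γ - 1) * (1 + Real.log n)) := by
  have hN : (0 : ℝ) < n := by positivity
  have hN1 : (1 : ℝ) ≤ n := by exact_mod_cast Nat.one_le_iff_ne_zero.mpr hn
  have hδ : 0 < (n : ℝ) ^ ((1 : ℝ) / 3) := by positivity
  have hδn : (n : ℝ) ^ ((1 : ℝ) / 3) ≤ n :=
    Real.rpow_le_self_of_one_le hN1 (by norm_num)
  have h0 : (0 : ℝ) ∉ Set.uIcc ((n : ℝ) ^ ((1 : ℝ) / 3)) n := by
    rw [Set.uIcc_of_le hδn]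
    exact fun h => absurd h.1 (not_le.mpr hδ)
  obtain ⟨hi, h⟩ := besselIntegrand_integral_le hγ hγ1.le (by linarith : 1 + γ < 2 * 1) hn
    hδ.le hδn (intervalIntegral.intervalIntegrable_rpow (Or.inr h0))
  refine ⟨hi, h.trans ?_⟩
  have hL : 0 ≤ Real.log n := Real.log_nonneg hN1
  have e0 : ∫ x in ((n : ℝ) ^ ((1 : ℝ) / 3))..n, x ^ (-1 : ℝ) = 2 / 3 * Real.log n := by
    simp only [Real.rpow_neg_one]
    rw [integral_inv h0, Real.log_div hN.ne' hδ.ne', Real.log_rpow hN]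
    ring
  rw [e0]
  simp only [Real.rpow_one, mul_one]
  have hA : 0 < (n : ℝ) ^ (γ - 1) := by positivity
  have e1 : (n : ℝ) ^ ((1 : ℝ) / 3) * ((2 * (n : ℝ)) ^ γ * (7 / 10 * (n : ℝ) ^ (-((4 : ℝ) / 3))))
      ≤ 7 / 5 * (n : ℝ) ^ (γ - 1) := by
    have e2 : (2 : ℝ) ^ γ ≤ 2 := Real.rpow_le_self_of_one_le (by norm_num) hγ1.le
    have e3 : (n : ℝ) ^ ((1 : ℝ) / 3) * (n : ℝ) ^ γ * (n : ℝ) ^ (-((4 : ℝ) / 3))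
        = (n : ℝ) ^ (γ - 1) := by
      rw [← Real.rpow_add hN, ← Real.rpow_add hN]
      ring_nf
    rw [Real.mul_rpow (by norm_num) hN.le]
    calc _ = 2 ^ γ * (7 / 10) * ((n : ℝ) ^ ((1 : ℝ) / 3) * (n : ℝ) ^ γ
          * (n : ℝ) ^ (-((4 : ℝ) / 3))) := by ring
      _ ≤ 2 * (7 / 10) * (n : ℝ) ^ (γ - 1) := by rw [e3]; gcongr
      _ = _ := by ring
  have e4 : (2 * (n : ℝ)) ^ (γ - 2 + 1) ≤ (n : ℝ) ^ (γ - 1) := by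
    rw [show γ - 2 + 1 = γ - 1 by ring]
    exact Real.rpow_le_rpow_of_nonpos hN (by linarith) (by linarith)
  have hd : 0 < 1 - γ := by linarith
  have e5 : (2 * (n : ℝ)) ^ (γ - 2 + 1) / (2 - γ - 1) ≤ (n : ℝ) ^ (γ - 1) / (1 - γ) := by
    rw [show 2 - γ - 1 = 1 - γ by ring]
    gcongr
  have e6 : (n : ℝ) ^ (γ - 1) ≤ (n : ℝ) ^ (γ - 1) / (1 - γ) := by
    rw [le_div_iff₀ hd]
    nlinarith
  have e7 : (n : ℝ) ^ (γ - 1) * Real.log n ≤ (n : ℝ) ^ (γ - 1) / (1 - γ) * Real.log n := by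
    gcongr
  have e8 : 4 / (1 - γ) * ((n : ℝ) ^ (γ - 1) * (1 + Real.log n))
      = 4 * ((n : ℝ) ^ (γ - 1) / (1 - γ)) + 4 * ((n : ℝ) ^ (γ - 1) / (1 - γ) * Real.log n) := by
    field_simp
  have h9 : 0 ≤ (n : ℝ) ^ (γ - 1) * Real.log n := by positivity
  rw [e8]
  linarith

theorem one_add_le_two_rpow (hs1 : 1 ≤ s) : 1 + s ≤ (2 : ℝ) ^ s := by
  have h := one_add_mul_self_le_rpow_one_add (by norm_num : (-1 : ℝ) ≤ 1) hs1
  norm_num at h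
  exact h

/-- With δ = n^(1/3), the side and middle pieces all have the order n^(γ + 1/3 - 4s/3), and the tail
is no larger. -/
theorem besselIntegrand_integral_le_of_one_lt (hγ : 0 ≤ γ) (hγ1 : γ ≤ 1)
    (hs : 1 < s) (hn : n ≠ 0) :
    IntegrableOn (besselIntegrand γ s n) (Set.Ioi 0) ∧
      ∫ t in Set.Ioi 0, besselIntegrand γ s n t ≤
        14 * (2 : ℝ) ^ s / (4 * s - 4) * (n : ℝ) ^ (γ + 1 / 3 - 4 * s / 3) := by
  have hN : (0 : ℝ) < n := by positivity
  have hN1 : (1 : ℝ) ≤ n := by exact_mod_cast Nat.one_le_iff_ne_zero.mpr hn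
  have hδ : 0 < (n : ℝ) ^ ((1 : ℝ) / 3) := by positivity
  have hδn : (n : ℝ) ^ ((1 : ℝ) / 3) ≤ n :=
    Real.rpow_le_self_of_one_le hN1 (by norm_num)
  have h0 : (0 : ℝ) ∉ Set.uIcc ((n : ℝ) ^ ((1 : ℝ) / 3)) n := by
    rw [Set.uIcc_of_le hδn]
    exact fun h => absurd h.1 (not_le.mpr hδ)
  obtain ⟨hi, h⟩ := besselIntegrand_integral_le hγ hγ1 (by linarith : 1 + γ < 2 * s) hn
    hδ.le hδn (intervalIntegral.intervalIntegrable_rpow (Or.inr h0))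
  refine ⟨hi, h.trans ?_⟩
  have hd : 0 < s - 1 := by linarith
  set B := (n : ℝ) ^ (γ + 1 / 3 - 4 * s / 3) with hB
  have hB0 : 0 < B := by positivity
  have c1 : ((9 : ℝ) / 16) ^ s ≤ 9 / 16 :=
    Real.rpow_le_self_of_le_one (by norm_num) (by norm_num) hs.le
  have c2 : ((7 : ℝ) / 10) ^ s ≤ 7 / 10 :=
    Real.rpow_le_self_of_le_one (by norm_num) (by norm_num) hs.le
  have c3 : ((3 : ℝ) / 4) ^ s ≤ 3 / 4 :=
    Real.rpow_le_self_of_le_one (by norm_num) (by norm_num) hs.le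
  have e0 : ∫ x in ((n : ℝ) ^ ((1 : ℝ) / 3))..n, x ^ (-s) ≤ (n : ℝ) ^ ((1 - s) / 3) / (s - 1) := by
    rw [integral_rpow (Or.inr ⟨by linarith, h0⟩), ← Real.rpow_mul hN.le,
      show (n : ℝ) ^ (-s + 1) - (n : ℝ) ^ (1 / 3 * (-s + 1))
        = -((n : ℝ) ^ ((1 - s) / 3) - (n : ℝ) ^ (-s + 1)) by ring_nf,
      show -s + 1 = -(s - 1) by ring, neg_div_neg_eq]
    have : 0 ≤ (n : ℝ) ^ (-(s - 1)) := by positivity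
    gcongr
    linarith
  have e1 : (9 / 16) ^ s * (n : ℝ) ^ (γ - s) * (∫ x in ((n : ℝ) ^ ((1 : ℝ) / 3))..n, x ^ (-s))
      ≤ 9 / 16 * (B / (s - 1)) := by
    calc _ ≤ 9 / 16 * (n : ℝ) ^ (γ - s) * ((n : ℝ) ^ ((1 - s) / 3) / (s - 1)) :=
          mul_le_mul (by gcongr) e0 (intervalIntegral.integral_nonneg hδn fun x hx =>
            Real.rpow_nonneg (hδ.le.trans hx.1) _) (by positivity)
      _ = 9 / 16 * (((n : ℝ) ^ (γ - s) * (n : ℝ) ^ ((1 - s) / 3)) / (s - 1)) := by ring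
      _ = _ := by
          rw [← Real.rpow_add hN, hB]
          ring_nf
  have e2 : 2 * (n : ℝ) ^ ((1 : ℝ) / 3) *
      ((2 * (n : ℝ)) ^ γ * ((7 / 10) ^ s * (n : ℝ) ^ (-(4 * s / 3)))) ≤ 14 / 5 * B := by
    have e2 : (2 : ℝ) ^ γ ≤ 2 := Real.rpow_le_self_of_one_le (by norm_num) hγ1
    have e3 : (n : ℝ) ^ ((1 : ℝ) / 3) * (n : ℝ) ^ γ * (n : ℝ) ^ (-(4 * s / 3)) = B := by
      rw [← Real.rpow_add hN, ← Real.rpow_add hN, hB]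
      ring_nf
    rw [Real.mul_rpow (by norm_num) hN.le]
    calc _ = 2 * 2 ^ γ * (7 / 10) ^ s * ((n : ℝ) ^ ((1 : ℝ) / 3) * (n : ℝ) ^ γ
          * (n : ℝ) ^ (-(4 * s / 3))) := by ring
      _ ≤ 2 * 2 * (7 / 10) * B := by rw [e3]; gcongr
      _ = _ := by ring
  have e3 : (3 / 4) ^ s * ((2 * (n : ℝ)) ^ (γ - 2 * s + 1) / (2 * s - γ - 1))
      ≤ 3 / 4 * (B / (s - 1)) := by
    have e4 : (2 * (n : ℝ)) ^ (γ - 2 * s + 1) ≤ B :=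
      (Real.rpow_le_rpow_of_nonpos hN (by linarith) (by linarith)).trans
        (Real.rpow_le_rpow_of_exponent_le hN1 (by linarith))
    have hd' : 0 < 2 * s - γ - 1 := by linarith
    gcongr
    linarith
  have e4 : 14 * (2 : ℝ) ^ s / (4 * s - 4) * B = 7 / 2 * 2 ^ s * (B / (s - 1)) := by
    rw [show 4 * s - 4 = 4 * (s - 1) by ring]
    field_simp
    ring
  have e5 : B = (s - 1) * (B / (s - 1)) := by field_simp
  have hX : 0 ≤ B / (s - 1) := by positivity
  -- 15/8 = 2 · 9/16 + 3/4 collects the side pieces and the tail; 14/5 is the middle piece.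
  -- Bernoulli's 1 + s ≤ 2^s absorbs the linear growth.
  have e6 : (15 / 8 + 14 / 5 * (s - 1)) * (B / (s - 1)) ≤ 7 / 2 * 2 ^ s * (B / (s - 1)) := by
    gcongr
    linarith [one_add_le_two_rpow hs.le]
  rw [e4]
  linarith

theorem besselIntegrand_zero_integral_le (hγ : 0 ≤ γ) (hs : 1 + γ < 2 * s) :
    IntegrableOn (besselIntegrand γ s 0) (Set.Ioi 1) ∧
      ∫ t in Set.Ioi 1, besselIntegrand γ s 0 t ≤ 1 / (2 * s - γ - 1) := by
  have h := besselIntegrand_far (n := 0) (c := 1) (a := 1) hs hγ one_pos one_pos (by simp)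
    (fun t _ => by simp)
  refine ⟨h.1, h.2.trans ?_⟩
  rw [Real.one_rpow, div_one]
  have hd : 0 < 2 * s - γ - 1 := by linarith
  exact mul_le_of_le_one_left (by positivity)
    (Real.rpow_le_one (by norm_num) (by norm_num) (by linarith))

theorem besselKappa_rpow_of_lt {p : ℝ} {k : ℤ} (hk : k ≠ 0) (hp0 : 0 < p) (hp : p < 4) :
    besselKappa γ p k ^ p = (k.natAbs : ℝ) ^ (γ - 2 * (p / 4) + 1) := by
  rw [besselKappa, if_neg hk, if_pos hp, Nat.cast_natAbs, Int.cast_abs,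
    ← Real.rpow_mul (abs_nonneg _)]
  congr 1
  field_simp
  ring

theorem besselKappa_rpow_four {k : ℤ} (hk : k ≠ 0) :
    besselKappa γ 4 k ^ (4 : ℝ)
      = (k.natAbs : ℝ) ^ (γ - 1) * (1 + Real.log k.natAbs) := by
  have hk1 : (1 : ℝ) ≤ k.natAbs := by exact_mod_cast Int.natAbs_pos.mpr hk
  have hL := Real.log_nonneg hk1
  have e : |(k : ℝ)| = k.natAbs := by rw [Nat.cast_natAbs, Int.cast_abs]
  rw [besselKappa, if_neg hk, if_neg (lt_irrefl _), if_pos rfl, e,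
    Real.mul_rpow (by positivity) (by positivity), ← Real.rpow_mul (by positivity),
    ← Real.rpow_mul (by positivity)]
  norm_num

theorem besselKappa_rpow_of_gt {p : ℝ} {k : ℤ} (hk : k ≠ 0) (hp : 4 < p) :
    besselKappa γ p k ^ p = (k.natAbs : ℝ) ^ (γ + 1 / 3 - 4 * (p / 4) / 3) := by
  have hp0 : 0 < p := by linarith
  rw [besselKappa, if_neg hk, if_neg hp.not_gt, if_neg hp.ne', Nat.cast_natAbs, Int.cast_abs,
    ← Real.rpow_mul (abs_nonneg _)]
  congr 1
  field_simp
  ring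

/-- Needed for n = 0, where the left side is the whole bound. -/
theorem one_div_le_besselConst {p : ℝ} (hγ1 : γ ≤ 1) (hp : 2 + 2 * γ < p) :
    1 / (2 * (p / 4) - γ - 1) ≤ besselConst γ p := by
  have hd : 0 < p - 2 - 2 * γ := by linarith
  have e : 1 / (2 * (p / 4) - γ - 1) = 2 / (p - 2 - 2 * γ) := by
    rw [show 2 * (p / 4) - γ - 1 = (p - 2 - 2 * γ) / 2 by ring]
    field_simp
  rw [e]
  unfold besselConst
  split_ifs with h h
  · have h1 : 0 ≤ 1 / (4 - p) := by
      have : 0 < 4 - p := by linarith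
      positivity
    have h2 : 0 ≤ 1 / (p - 2 - 2 * γ) := by positivity
    have h3 : 2 / (p - 2 - 2 * γ) = 2 * (1 / (p - 2 - 2 * γ)) := by ring
    linarith
  · subst h
    have h1 : 0 < 1 - γ := by linarith
    rw [show (4 : ℝ) - 2 - 2 * γ = 2 * (1 - γ) by ring, div_le_div_iff₀ (by positivity) h1]
    linarith
  · have h1 : 4 < p := lt_of_le_of_ne (not_lt.mp (by assumption)) (Ne.symm h)
    have h2 : 1 + p / 4 ≤ (2 : ℝ) ^ (p / 4) := one_add_le_two_rpow (by linarith)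
    have h3 : 0 < p - 4 := by linarith
    gcongr ?_ / ?_ <;> linarith

end Cases

theorem lemmaB1 (γ p : ℝ) (hγ : γ ∈ Set.Icc (0 : ℝ) 1) (hp : 2 + 2 * γ < p) (n : ℤ) :
    MeasureTheory.IntegrableOn (fun t : ℝ => t ^ γ * ‖besselJ n t‖ ^ p) (Set.Ioi (1 : ℝ)) ∧
      ∫ t in Set.Ioi (1 : ℝ), t ^ γ * ‖besselJ n t‖ ^ p
        ≤ besselConst γ p * besselKappa γ p n ^ p := by
  obtain ⟨hγ0, hγ1⟩ := hγ
  have hf : (fun t : ℝ => t ^ γ * ‖besselJ n t‖ ^ p) = besselIntegrand γ (p / 4) n.natAbs :=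
    funext fun t => by rw [norm_besselJ_rpow_eq, besselIntegrand]
  rw [hf]
  rcases eq_or_ne n 0 with rfl | hn
  · have h := besselIntegrand_zero_integral_le (s := p / 4) hγ0 (by linarith)
    refine ⟨h.1, h.2.trans ?_⟩
    rw [besselKappa, if_pos rfl, Real.one_rpow, mul_one]
    exact one_div_le_besselConst hγ1 hp
  have hn' : n.natAbs ≠ 0 := Int.natAbs_ne_zero.mpr hn
  -- For n ≠ 0 the integral over all of (0, ∞) already obeys the bound.
  suffices h : IntegrableOn (besselIntegrand γ (p / 4) n.natAbs) (Set.Ioi 0) ∧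
      ∫ t in Set.Ioi 0, besselIntegrand γ (p / 4) n.natAbs t
        ≤ besselConst γ p * besselKappa γ p n ^ p by
    have hsub : Set.Ioi (1 : ℝ) ⊆ Set.Ioi 0 := Set.Ioi_subset_Ioi zero_le_one
    refine ⟨h.1.mono_set hsub, le_trans ?_ h.2⟩
    refine setIntegral_mono_set h.1 ?_ hsub.eventuallyLE
    filter_upwards [ae_restrict_mem measurableSet_Ioi] with t ht
    exact besselIntegrand_nonneg _ _ _ (le_of_lt ht)
  rcases lt_trichotomy p 4 with h4 | h4 | h4
  · have h := besselIntegrand_integral_le_of_lt_one (s := p / 4) hγ0 hγ1 (by linarith)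
      (by linarith) hn'
    rw [besselKappa_rpow_of_lt hn (by linarith) h4, besselConst, if_pos h4]
    rwa [mul_div_cancel₀ p four_ne_zero] at h
  · subst h4
    have h := besselIntegrand_integral_le_one hγ0 (by linarith : γ < 1) hn'
    rw [besselKappa_rpow_four hn, besselConst, if_neg (lt_irrefl _), if_pos rfl,
      div_self four_ne_zero]
    exact h
  · have h := besselIntegrand_integral_le_of_one_lt (s := p / 4) hγ0 hγ1 (by linarith) hn'
    rw [besselKappa_rpow_of_gt hn h4, besselConst, if_neg h4.not_gt, if_neg h4.ne']
    rw [mul_div_cancel₀ p four_ne_zero] at h ⊢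
    exact h

end
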